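/- **Setting.** A set partition $\pi\vdash[n]$ of $[n]=\{1,\dots,n\}$ has block sizes forming an integer partition $\lambda(\pi)$ of $n$; for an integer partition $\lambda=(\lambda_1\ge\dots\ge\lambda_\ell)$ put $\lambda!=\lambda_1!\cdots\lambda_\ell!$. In $\mathbb Q\langle\langle x_1,x_2,\dots\rangle\rangle$ (formal power series in noncommuting variables) let $m_\pi=\sum x_{i_1}\cdots x_{i_n}$, summed over all $(i_1,\dots,i_n)$ such that $i_j=i_k$ if and only if $j,k$ lie in the same block of $\pi$; let $\mathrm{NCSym}^n=\operatorname{span}_{\mathbb Q}\{m_\pi:\pi\vdash[n]\}$, and let $h_\pi=\sum_{\sigma\vdash[n]}\lambda(\sigma\wedge\pi)!\,m_\sigma$, where the blocks of $\sigma\wedge\pi$ are the nonempty intersections of a block of $\sigma$ with a block of $\pi$. For $k\ge 1$ let $h_{[k]}=h_\pi$ for the one-block set partition $\pi$ of $[k]$; put $h_{[0]}=1$ and, for $k<0$, $\frac1{k!}h_{[k]}=0$. A permutation $\delta\in\mathfrak S_n$ acts linearly on $\mathrm{NCSym}^n$ by $\delta\circ m_\pi=m_{\delta\pi}$, where $\delta\pi=\{\delta(B):B\in\pi\}$.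 Let $\rho:\mathbb Q\langle\langle x_1,x_2,\dots\rangle\rangle\to\mathbb Q[[x_1,x_2,\dots]]$ be the map letting the variables commute. For an integer partition $\lambda=(\lambda_1\ge\dots\ge\lambda_\ell)$ of $n$ let $$s_{[\lambda]}=\sum_{\varepsilon\in\mathfrak S_\ell}\operatorname{sgn}(\varepsilon)\,a_{1\varepsilon(1)}a_{2\varepsilon(2)}\cdots a_{\ell\varepsilon(\ell)},\qquad a_{ij}=\frac{1}{(\lambda_i-i+j)!}\,h_{[\lambda_i-i+j]},$$ and let $s_\lambda=\det(h_{\lambda_i-i+j})_{1\le i,j\le\ell}$ be the classical Schur function, where $h_k$ is the sum of all monomials of degree $k$ in $x_1,x_2,\dots$ (and $h_k=0$ for $k<0$). For $\pi\vdash[n]$ let $\delta_\pi\in\mathfrak S_n$ be the permutation whose one-line notation lists the blocks of $\pi$ one after the other, each in increasing order, larger blocks first, and blocks of equal size in the order of their least elements. The standard Schur function in noncommuting variables is $s_\pi=\delta_\pi\circ s_{[\lambda(\pi)]}$. **Corollary 4.6.** Let $n\ge 5$ and let $\delta,\eta\in\mathfrak S_n$. 1. The family $(\delta\circ s_\pi)_{\pi\vdash[n]}$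 is a basis of $\mathrm{NCSym}^n$. 2. If $\delta\ne\mathrm{id}$, then $\{s_\pi:\pi\vdash[n]\}$ and $\{\delta\circ s_\pi:\pi\vdash[n]\}$ are different bases of $\mathrm{NCSym}^n$. 3. If $\{\delta\circ s_\pi:\pi\vdash[n]\}=\{\eta\circ s_\pi:\pi\vdash[n]\}$, then $\delta=\eta$. Hence there are exactly $n!$ distinct bases of the form $\{\delta\circ s_\pi:\pi\vdash[n]\}$ with $\delta\in\mathfrak S_n$. 4. $\rho(\delta\circ s_\pi)=s_{\lambda(\pi)}$ for every $\pi\vdash[n]$. -/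

import Mathlib

namespace NCSchur

/-! ### Formal power series in the noncommuting variables `x_0, x_1, x_2, …` over `ℚ`

A word in the variables is a list of indices; a series is the family of its coefficients. -/

/-- The algebra `ℚ⟨⟨x_0, x_1, …⟩⟩`: `f w` is the coefficient of the word `w` in `f`. -/
def NCSeries : Type := List ℕ → ℚ

namespace NCSeries

instance : AddCommGroup NCSeries := inferInstanceAs (AddCommGroup (List ℕ → ℚ))

instance : Module ℚ NCSeries := inferInstanceAs (Module ℚ (List ℕ → ℚ))

instance : One NCSeries := ⟨fun w => if w = [] then 1 else 0⟩

/-- The product concatenates words: the coefficient of `w` in `f * g` is the sum of `f u * g v` over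
all factorizations `w = u v`. -/
instance : Mul NCSeries :=
  ⟨fun f g w => ∑ k ∈ Finset.range (w.length + 1), f (w.take k) * g (w.drop k)⟩

end NCSeries

/-- The words whose commutative image is the monomial with exponents `d`. -/
noncomputable def wordsOf (d : ℕ →₀ ℕ) : Finset (List ℕ) := (Finsupp.toMultiset d).lists.toFinset

theorem mem_wordsOf (d : ℕ →₀ ℕ) (w : List ℕ) :
    w ∈ wordsOf d ↔ (w : Multiset ℕ) = Finsupp.toMultiset d := by
  rw [wordsOf, Multiset.mem_toFinset, Multiset.mem_lists_iff, eq_comm]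
  rfl

/-- The projection `ρ : ℚ⟨⟨x_0, x_1, …⟩⟩ → ℚ[[x_0, x_1, …]]` letting the variables commute. -/
noncomputable def rho : NCSeries →ₗ[ℚ] MvPowerSeries ℕ ℚ where
  toFun f := fun d => ∑ w ∈ wordsOf d, f w
  map_add' _ _ := funext fun _ => Finset.sum_add_distrib
  map_smul' _ _ := funext fun _ => (Finset.mul_sum _ _ _).symm

/-- The word `i_{δ(1)} ⋯ i_{δ(n)}`, for a word `i_1 ⋯ i_n` of length `n` (words of other lengths are
left alone). -/
def permWord {n : ℕ} (δ : Equiv.Perm (Fin n)) (w : List ℕ) : List ℕ :=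
  if h : w.length = n then List.ofFn fun j : Fin n => w.get ((δ j).cast h.symm) else w

/-- The place permutation by `δ` on series of degree `n`, extended linearly from
`δ ∘ (x_{i_1} ⋯ x_{i_n}) = x_{i_{δ⁻¹(1)}} ⋯ x_{i_{δ⁻¹(n)}}`. In terms of coefficients, the word
`i_1 ⋯ i_n` gets the coefficient that `i_{δ(1)} ⋯ i_{δ(n)}` had. -/
def permAct {n : ℕ} (δ : Equiv.Perm (Fin n)) : NCSeries →ₗ[ℚ] NCSeries where
  toFun f := fun w => f (permWord δ w)
  map_add' _ _ := rfl
  map_smul' _ _ := rfl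

/-! ### Set partitions -/

/-- Set partitions of an `n`-element set, here `{0, …, n - 1}`. -/
abbrev SetPartition (n : ℕ) : Type := Finpartition (Finset.univ : Finset (Fin n))

namespace SetPartition

/-- The integer partition `λ(π)` of `n` formed by the block sizes of `π`. -/
def shape {n : ℕ} (π : SetPartition n) : Nat.Partition n where
  parts := π.parts.val.map Finset.card
  parts_pos := by
    intro i hi
    obtain ⟨B, hB, rfl⟩ := Multiset.mem_map.1 hi
    exact Finset.card_pos.2 (π.nonempty_of_mem_parts hB)
  parts_sum := by
    have h := π.sum_card_parts
    rw [Finset.card_univ, Fintype.card_fin] at h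
    exact h

/-- `λ(π)! = ∏ |B|!` over the blocks `B` of `π`. -/
def blockFactorial {n : ℕ} (π : SetPartition n) : ℕ := ∏ B ∈ π.parts, B.card.factorial

/-- The natural action `δπ = {δ(B) : B ∈ π}` of a permutation on a set partition. -/
def perm {n : ℕ} (δ : Equiv.Perm (Fin n)) (π : SetPartition n) : SetPartition n :=
  (π.map (a := Finset.univ) (β := Finset (Fin n))
    { δ.finsetCongr with map_rel_iff' := by intro a b; simp }).copy (by simp)

end SetPartition

/-- The tableau attached to `π` has the blocks of `π` as rows, each row increasing, the rows ordered
by decreasing size and rows of equal size by increasing leftmost entry. This key compares two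
entries by their position in the reading word (left to right, top to bottom) of that tableau:
first by size of the row, then by leftmost entry of the row, then by the entry itself. -/
def readingKey {n : ℕ} (π : SetPartition n) (a : Fin n) :
    ℕᵒᵈ ×ₗ WithTop (Fin n) ×ₗ Fin n :=
  toLex (OrderDual.toDual (π.part a).card, toLex ((π.part a).min, a))

/-- The permutation `δ_π`: its one-line notation `δ_π(1) δ_π(2) ⋯ δ_π(n)` is the reading word of the
tableau attached to `π`, that is, the entries listed by increasing `readingKey`. -/
def readingPerm {n : ℕ} (π : SetPartition n) : Equiv.Perm (Fin n) :=
  Tuple.sort (readingKey π)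

/-! ### Symmetric functions in noncommuting variables -/

/-- The monomial symmetric function `m_π`, the sum of the words `x_{i_1} ⋯ x_{i_n}` such that
`i_j = i_k` if and only if `j` and `k` are in the same block of `π`. -/
def mNC {n : ℕ} (π : SetPartition n) : NCSeries := fun w =>
  if h : w.length = n then
    if ∀ j k : Fin n, w.get (j.cast h.symm) = w.get (k.cast h.symm) ↔ π.part j = π.part k
    then 1 else 0
  else 0

/-- The complete homogeneous symmetric function `h_π = ∑_σ λ(σ ∧ π)! m_σ`. -/
def hNC {n : ℕ} (π : SetPartition n) : NCSeries :=
  ∑ σ : SetPartition n, ((σ ⊓ π).blockFactorial : ℚ) • mNC σ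

/-- The graded piece `NCSym^n`. -/
def NCSym (n : ℕ) : Submodule ℚ NCSeries :=
  Submodule.span ℚ (Set.range fun π : SetPartition n => mNC π)

/-- The noncommutative Leibniz determinant, each product taken from the top row to the bottom. -/
def ncDet {l : ℕ} (A : Matrix (Fin l) (Fin l) NCSeries) : NCSeries :=
  ∑ ε : Equiv.Perm (Fin l),
    ((Equiv.Perm.sign ε : ℤ) : ℚ) • (List.ofFn fun i => A i (ε i)).prod

/-- `h_{[k]} / k!`, where `[k]` is the set partition with a single block (no block if `k = 0`),
and `0` for negative `k`. -/
def hRow (k : ℤ) : NCSeries :=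
  if 0 ≤ k then (1 / (k.toNat.factorial : ℚ)) • hNC (⊤ : SetPartition k.toNat) else 0

/-- The parts `λ_1 ≥ λ_2 ≥ ⋯` of an integer partition. -/
def rows {n : ℕ} (lam : Nat.Partition n) : List ℕ := lam.parts.sort (· ≥ ·)

/-- The source Schur function `s_{[λ]}`, the noncommutative determinant of the matrix with entries
`h_{[λ_i - i + j]} / (λ_i - i + j)!`. -/
def sourceSchur {n : ℕ} (lam : Nat.Partition n) : NCSeries :=
  ncDet (Matrix.of fun i j : Fin (rows lam).length =>
    hRow (((rows lam).get i : ℤ) - (i : ℤ) + (j : ℤ)))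

/-- The standard Schur function in noncommuting variables, `s_π = δ_π ∘ s_{[λ(π)]}`. -/
def schurNC {n : ℕ} (π : SetPartition n) : NCSeries :=
  permAct (readingPerm π) (sourceSchur π.shape)

/-! ### Classical Schur functions -/

/-- The complete homogeneous symmetric function `h_k`, the sum of all monomials of degree `k`
(zero for negative `k`). -/
noncomputable def hSym (k : ℤ) : MvPowerSeries ℕ ℚ :=
  fun d => if (d.degree : ℤ) = k then 1 else 0

/-- The classical Schur function `s_λ = det (h_{λ_i - i + j})`. -/
noncomputable def schur {n : ℕ} (lam : Nat.Partition n) : MvPowerSeries ℕ ℚ :=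
  Matrix.det (Matrix.of fun i j : Fin (rows lam).length =>
    hSym (((rows lam).get i : ℤ) - (i : ℤ) + (j : ℤ)))

/-! ### The permutation map on the monomial basis -/

theorem SetPartition.part_perm_eq_iff {n : ℕ} (δ : Equiv.Perm (Fin n)) (π : SetPartition n)
    (j k : Fin n) : (π.perm δ).part (δ j) = (π.perm δ).part (δ k) ↔ π.part j = π.part k := by
  have key : ∀ a, (SetPartition.perm δ π).part (δ a) = (π.part a).map δ.toEmbedding := by
    intro a
    apply Finpartition.part_eq_of_mem
    · simp only [SetPartition.perm, Finpartition.copy, Finpartition.map, Finset.mem_map]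
      exact ⟨π.part a, π.part_mem.2 (Finset.mem_univ a), rfl⟩
    · exact Finset.mem_map.2 ⟨a, π.mem_part (Finset.mem_univ a), rfl⟩
  rw [key, key, Finset.map_inj]

/-- The permutation map satisfies `δ ∘ m_π = m_{δπ}`; being linear, it is determined on `NCSym^n`
by this rule. -/
theorem permAct_mNC {n : ℕ} (δ : Equiv.Perm (Fin n)) (π : SetPartition n) :
    permAct δ (mNC π) = mNC (π.perm δ) := by
  funext w
  change mNC π (permWord δ w) = _
  by_cases h : w.length = n
  · rw [permWord, dif_pos h, mNC, mNC, dif_pos (List.length_ofFn), dif_pos h]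
    congr 1
    refine propext (δ.forall_congr fun {j} => δ.forall_congr fun {k} => ?_)
    rw [SetPartition.part_perm_eq_iff]
    simp
  · rw [permWord, dif_neg h, mNC, mNC, dif_neg h, dif_neg h]

end NCSchur

/-!
Both bases are compared with the complete homogeneous functions `h_π`. These are linearly
independent because their Gram matrix `λ(σ ∧ π)!` counts the place permutations that preserve the
blocks of `σ` and of `π`, so that its quadratic form is a sum of squares indexed by permutations
(`linearIndependent_hNC`).

A product of functions `h_{[k]}` is `h_τ` for a partition `τ` into consecutive intervals
(`prod_hRow_nat`), and the reading permutation carries the intervals of lengths `λ(π)` to the blocks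
of `π` (`runPartition_perm_readingPerm`). Expanding the determinant thus gives
`s_π = c h_π + ∑ c_τ h_τ` with `c ≠ 0`. By the rearrangement inequality, applied to the strictly
decreasing sequence `λ_i - i`, each `τ` in the sum has a larger sum of squared block sizes than `π`
(`sum_sq_lt_sum_sq_shiftedRows`, `exists_schurNC_expansion`). This triangularity gives the bases, and
the place permutations act on `NCSym^n` by automorphisms that permute the `h_π`.

For distinctness, let `γ` carry Schur functions to Schur functions. If `π` has the blocks `{x < y}`
and its complement, which is larger since `n ≥ 5`, then `s_π` is a combination with nonzero
coefficients of `h_π` and `h_τ`, where `τ` has the blocks `{y}` and its complement. Comparing leading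
terms, `γ s_π = s_{γπ}`; the second term then says that `γ y` is the larger entry of `{γ x, γ y}`.
So `γ` is increasing, and it is the identity (`eq_one_of_permAct_schurNC`).

The commutative image turns concatenation into multiplication and ignores place permutations, and it
sends `h_{[k]}` to `k! h_k` by orbit counting (`rho_hNC_top`); hence it sends the noncommutative
determinant to the Jacobi–Trudi determinant.
-/

namespace NCSchur

/-! ### Series, place permutations and the commutative image -/

theorem NCSeries.mul_apply (f g : NCSeries) (w : List ℕ) :
    (f * g) w = ∑ k ∈ Finset.range (w.length + 1), f (w.take k) * g (w.drop k) := rfl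

theorem NCSeries.one_apply (w : List ℕ) : (1 : NCSeries) w = if w = [] then 1 else 0 := rfl

theorem NCSeries.zero_apply (w : List ℕ) : (0 : NCSeries) w = 0 := rfl

theorem NCSeries.smul_apply (c : ℚ) (f : NCSeries) (w : List ℕ) : (c • f) w = c * f w := rfl

theorem NCSeries.sum_apply {ι : Type*} (s : Finset ι) (f : ι → NCSeries) (w : List ℕ) :
    (∑ i ∈ s, f i) w = ∑ i ∈ s, f i w :=
  Finset.sum_apply w s (fun i => (f i : List ℕ → ℚ))

theorem NCSeries.zero_mul (f : NCSeries) : 0 * f = 0 := by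
  funext w
  simp [mul_apply, zero_apply]

theorem NCSeries.mul_zero (f : NCSeries) : f * 0 = 0 := by
  funext w
  simp [mul_apply, zero_apply]

theorem NCSeries.smul_mul_smul (a b : ℚ) (f g : NCSeries) :
    (a • f) * (b • g) = (a * b) • (f * g) := by
  funext w
  simp only [mul_apply, smul_apply, Finset.mul_sum]
  exact Finset.sum_congr rfl fun _ _ => by ring

theorem permWord_perm {n : ℕ} (δ : Equiv.Perm (Fin n)) (w : List ℕ) :
    (permWord δ w).Perm w := by
  unfold permWord
  split_ifs with h
  · subst h
    have := Equiv.Perm.ofFn_comp_perm δ w.get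
    simpa [Function.comp_def] using this
  · rfl

theorem permWord_ofFn {n : ℕ} (δ : Equiv.Perm (Fin n)) (u : Fin n → ℕ) :
    permWord δ (List.ofFn u) = List.ofFn (u ∘ δ) := by
  rw [permWord, dif_pos List.length_ofFn]
  congr 1
  funext j
  simp

theorem exists_eq_ofFn {n : ℕ} {w : List ℕ} (h : w.length = n) :
    ∃ u : Fin n → ℕ, w = List.ofFn u := by
  subst h
  exact ⟨w.get, (List.ofFn_get w).symm⟩

theorem permWord_permWord {n : ℕ} (δ η : Equiv.Perm (Fin n)) (w : List ℕ) :
    permWord η (permWord δ w) = permWord (δ * η) w := by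
  by_cases h : w.length = n
  · obtain ⟨u, rfl⟩ := exists_eq_ofFn h
    rw [permWord_ofFn, permWord_ofFn, permWord_ofFn, Function.comp_assoc, Equiv.Perm.coe_mul]
  · have h' : (permWord δ w).length ≠ n := by rwa [(permWord_perm δ w).length_eq]
    rw [permWord, dif_neg h', permWord, dif_neg h, permWord, dif_neg h]

theorem permWord_one {n : ℕ} (w : List ℕ) : permWord (1 : Equiv.Perm (Fin n)) w = w := by
  unfold permWord
  split_ifs with h
  · subst h
    simp
  · rfl

theorem permAct_permAct {n : ℕ} (δ η : Equiv.Perm (Fin n)) (f : NCSeries) :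
    permAct δ (permAct η f) = permAct (δ * η) f := by
  funext w
  exact congrArg f (permWord_permWord δ η w)

theorem permAct_one {n : ℕ} (f : NCSeries) : permAct (1 : Equiv.Perm (Fin n)) f = f := by
  funext w
  exact congrArg f (permWord_one w)

theorem permAct_injective {n : ℕ} (δ : Equiv.Perm (Fin n)) :
    Function.Injective (permAct δ) := fun f g h => by
  have := congrArg (permAct δ⁻¹) h
  simpa only [permAct_permAct, inv_mul_cancel, permAct_one] using this

theorem rho_apply (f : NCSeries) (d : ℕ →₀ ℕ) :
    MvPowerSeries.coeff d (rho f) = ∑ w ∈ wordsOf d, f w := rfl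

theorem rho_permAct {n : ℕ} (δ : Equiv.Perm (Fin n)) (f : NCSeries) :
    rho (permAct δ f) = rho f := by
  ext d
  rw [rho_apply, rho_apply]
  have hmem : ∀ (δ : Equiv.Perm (Fin n)) (w : List ℕ), w ∈ wordsOf d → permWord δ w ∈ wordsOf d := by
    intro δ w hw
    rw [mem_wordsOf] at hw ⊢
    rw [← hw]
    exact Multiset.coe_eq_coe.2 (permWord_perm δ w)
  refine Finset.sum_bij' (fun w _ => permWord δ w) (fun w _ => permWord δ⁻¹ w)
    (hmem δ) (hmem δ⁻¹) ?_ ?_ fun _ _ => rfl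
  · intro w _
    rw [permWord_permWord, mul_inv_cancel, permWord_one]
  · intro w _
    rw [permWord_permWord, inv_mul_cancel, permWord_one]

theorem rho_one : rho 1 = 1 := by
  ext d
  rw [rho_apply, MvPowerSeries.coeff_one]
  simp only [NCSeries.one_apply, Finset.sum_ite_eq', mem_wordsOf]
  congr 1
  rw [Multiset.coe_nil, eq_comm (a := d), eq_iff_iff]
  constructor
  · intro h
    rw [← Finsupp.toMultiset_toFinsupp d, ← h]
    rfl
  · rintro rfl
    rw [map_zero]

/-- A factorization of a word with commutative image `d` is a pair of words whose commutative images
multiply to `d`. -/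
theorem sum_wordsOf_splits (f g : List ℕ → ℚ) (d : ℕ →₀ ℕ) :
    ∑ w ∈ wordsOf d, ∑ k ∈ Finset.range (w.length + 1), f (w.take k) * g (w.drop k) =
      ∑ p ∈ Finset.HasAntidiagonal.antidiagonal d,
        (∑ u ∈ wordsOf p.1, f u) * ∑ v ∈ wordsOf p.2, g v := by
  simp only [Finset.sum_mul_sum, ← Finset.sum_product']
  rw [Finset.sum_sigma', Finset.sum_sigma']
  refine Finset.sum_bij'
    (fun p _ => ⟨(Multiset.toFinsupp (p.1.take p.2 : Multiset ℕ),
      Multiset.toFinsupp (p.1.drop p.2 : Multiset ℕ)), (p.1.take p.2, p.1.drop p.2)⟩)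
    (fun q _ => ⟨q.2.1 ++ q.2.2, q.2.1.length⟩) ?_ ?_ ?_ ?_ ?_
  · rintro ⟨w, k⟩ h
    simp only [Finset.mem_sigma, mem_wordsOf, Finset.mem_range] at h
    simp only [Finset.mem_sigma, Finset.mem_product, mem_wordsOf,
      Finset.HasAntidiagonal.mem_antidiagonal, Multiset.toFinsupp_toMultiset, and_self, and_true]
    rw [← map_add, Multiset.coe_add, List.take_append_drop, h.1, Finsupp.toMultiset_toFinsupp]
  · rintro ⟨⟨a, b⟩, ⟨u, v⟩⟩ h
    simp only [Finset.mem_sigma, Finset.mem_product, mem_wordsOf,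
      Finset.HasAntidiagonal.mem_antidiagonal] at h
    simp only [Finset.mem_sigma, mem_wordsOf, Finset.mem_range, List.length_append]
    refine ⟨?_, by omega⟩
    rw [← Multiset.coe_add, h.2.1, h.2.2, ← map_add, h.1]
  · rintro ⟨w, k⟩ h
    simp only [Finset.mem_sigma, Finset.mem_range] at h
    simp only [List.take_append_drop, List.length_take, Sigma.mk.injEq, heq_eq_eq, true_and]
    omega
  · rintro ⟨⟨a, b⟩, ⟨u, v⟩⟩ h
    simp only [Finset.mem_sigma, Finset.mem_product, mem_wordsOf,
      Finset.HasAntidiagonal.mem_antidiagonal] at h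
    simp [h.2.1, h.2.2]
  · rintro ⟨w, k⟩ h
    rfl

theorem rho_mul (f g : NCSeries) : rho (f * g) = rho f * rho g := by
  ext d
  rw [MvPowerSeries.coeff_mul]
  exact sum_wordsOf_splits f g d

theorem rho_list_prod (l : List NCSeries) : rho l.prod = (l.map rho).prod := by
  induction l with
  | nil => exact rho_one
  | cons f l ih => rw [List.prod_cons, rho_mul, ih, List.map_cons, List.prod_cons]

theorem rho_ncDet {l : ℕ} (A : Matrix (Fin l) (Fin l) NCSeries) :
    rho (ncDet A) = (A.map rho).det := by
  rw [← Matrix.det_transpose, Matrix.det_apply', ncDet, map_sum]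
  refine Finset.sum_congr rfl fun ε _ => ?_
  rw [map_smul, rho_list_prod, List.map_ofFn, List.prod_ofFn, Algebra.smul_def]
  simp

/-! ### Set partitions as kernels, and the complete homogeneous basis -/

namespace SetPartition

variable {n : ℕ}

theorem mem_part_iff (σ : SetPartition n) (j k : Fin n) :
    k ∈ σ.part j ↔ σ.part j = σ.part k := by
  rw [σ.mem_part_iff_part_eq_part (Finset.mem_univ k) (Finset.mem_univ j), eq_comm]

theorem image_part (σ : SetPartition n) : Finset.univ.image σ.part = σ.parts := by
  ext B
  simp only [Finset.mem_image, Finset.mem_univ, true_and]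
  constructor
  · rintro ⟨a, rfl⟩
    exact σ.part_mem.2 (Finset.mem_univ a)
  · intro hB
    obtain ⟨a, ha⟩ := σ.nonempty_of_mem_parts hB
    exact ⟨a, σ.part_eq_of_mem hB ha⟩

theorem ext_part {σ τ : SetPartition n}
    (h : ∀ j k, σ.part j = σ.part k ↔ τ.part j = τ.part k) : σ = τ := by
  have : σ.part = τ.part := by
    funext j
    ext k
    rw [mem_part_iff, mem_part_iff, h]
  apply Finpartition.ext
  rw [← image_part, ← image_part, this]

theorem part_inf_eq_iff (σ τ : SetPartition n) (j k : Fin n) :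
    (σ ⊓ τ).part j = (σ ⊓ τ).part k ↔ σ.part j = σ.part k ∧ τ.part j = τ.part k := by
  have key : ∀ a, (σ ⊓ τ).part a = σ.part a ∩ τ.part a := by
    intro a
    have ha : a ∈ σ.part a ∩ τ.part a :=
      Finset.mem_inter.2 ⟨σ.mem_part (Finset.mem_univ a), τ.mem_part (Finset.mem_univ a)⟩
    refine Finpartition.part_eq_of_mem _ ?_ ha
    rw [Finpartition.parts_inf, Finset.mem_erase]
    refine ⟨Finset.ne_empty_of_mem ha, Finset.mem_image.2 ⟨(σ.part a, τ.part a), ?_, rfl⟩⟩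
    exact Finset.mem_product.2
      ⟨σ.part_mem.2 (Finset.mem_univ a), τ.part_mem.2 (Finset.mem_univ a)⟩
  rw [← mem_part_iff, key, Finset.mem_inter, mem_part_iff, mem_part_iff]

theorem part_top_eq (j k : Fin n) :
    (⊤ : SetPartition n).part j = (⊤ : SetPartition n).part k := by
  have h : ∀ a, (⊤ : SetPartition n).part a = Finset.univ := fun a =>
    Finset.mem_singleton.1 (Finpartition.parts_top_subset _
      ((Finpartition.part_mem _).2 (Finset.mem_univ a)))
  rw [h, h]

/-- The set partition of the positions into the nonempty fibers of a labelling. -/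
noncomputable def ker {α : Type*} (f : Fin n → α) : SetPartition n :=
  letI : DecidableRel ⇑(Setoid.ker f) := Classical.decRel _
  Finpartition.ofSetoid (Setoid.ker f)

theorem part_ker_eq_iff {α : Type*} (f : Fin n → α) (j k : Fin n) :
    (ker f).part j = (ker f).part k ↔ f j = f k := by
  let : DecidableRel ⇑(Setoid.ker f) := Classical.decRel _
  rw [← mem_part_iff, ker, Finpartition.mem_part_ofSetoid_iff_rel]
  exact Setoid.ker_def

theorem perm_mul (δ η : Equiv.Perm (Fin n)) (π : SetPartition n) :
    (π.perm η).perm δ = π.perm (δ * η) := by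
  refine ext_part fun j k => ?_
  have h : ∀ (δ : Equiv.Perm (Fin n)) (π : SetPartition n) (j k : Fin n),
      (π.perm δ).part j = (π.perm δ).part k ↔ π.part (δ⁻¹ j) = π.part (δ⁻¹ k) := by
    intro δ π j k
    rw [← part_perm_eq_iff δ π, Equiv.Perm.inv_def, δ.apply_symm_apply, δ.apply_symm_apply]
  rw [h, h, h, mul_inv_rev]
  rfl

theorem perm_one (π : SetPartition n) : π.perm 1 = π :=
  ext_part fun j k => part_perm_eq_iff 1 π j k

/-- The number of permutations of the positions that preserve a labelling. -/
def stabCount {α : Type*} [DecidableEq α] (f : Fin n → α) : ℕ :=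
  (Finset.univ.filter fun g : Equiv.Perm (Fin n) => ∀ j, f (g j) = f j).card

theorem stabCount_congr {α β : Type*} [DecidableEq α] [DecidableEq β] {f : Fin n → α}
    {f' : Fin n → β} (h : ∀ j k, f j = f k ↔ f' j = f' k) : stabCount f = stabCount f' := by
  unfold stabCount
  simp only [h]

theorem stabCount_eq_prod {α : Type*} [DecidableEq α] (f : Fin n → α) :
    stabCount f =
      ∏ x ∈ Finset.univ.image f, (Finset.univ.filter fun j => f j = x).card.factorial := by
  have := DomMulAct.stabilizer_card' (f := f)
  simp only [Fintype.card_subtype, funext_iff, Function.comp_apply] at this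
  exact this

theorem blockFactorial_eq_stabCount {α : Type*} [DecidableEq α] {f : Fin n → α}
    {σ : SetPartition n} (h : ∀ j k, σ.part j = σ.part k ↔ f j = f k) :
    σ.blockFactorial = stabCount f := by
  rw [← stabCount_congr h, stabCount_eq_prod, image_part, blockFactorial]
  refine Finset.prod_congr rfl fun B hB => ?_
  congr 2
  ext j
  simp [σ.part_eq_iff_mem hB]

end SetPartition

open SetPartition

theorem mNC_ofFn {n : ℕ} (π : SetPartition n) (u : Fin n → ℕ) :
    mNC π (List.ofFn u) = if π = ker u then 1 else 0 := by
  rw [mNC, dif_pos List.length_ofFn]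
  congr 1
  simp only [List.get_ofFn, Fin.cast_cast, Fin.cast_eq_self, eq_iff_iff]
  constructor
  · intro h
    refine ext_part fun j k => ?_
    rw [part_ker_eq_iff, h]
  · rintro rfl j k
    rw [part_ker_eq_iff]

theorem mNC_of_length_ne {n : ℕ} (π : SetPartition n) {w : List ℕ} (h : w.length ≠ n) :
    mNC π w = 0 := dif_neg h

theorem hNC_of_length_ne {n : ℕ} (π : SetPartition n) {w : List ℕ} (h : w.length ≠ n) :
    hNC π w = 0 := by
  rw [hNC, NCSeries.sum_apply]
  refine Finset.sum_eq_zero fun σ _ => ?_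
  rw [NCSeries.smul_apply, mNC_of_length_ne σ h, mul_zero]

/-- The coefficient of a word in `h_π` counts the place permutations that preserve both the word and
the blocks of `π`. -/
theorem hNC_ofFn {n : ℕ} {α : Type*} [DecidableEq α] {π : SetPartition n} {f : Fin n → α}
    (hf : ∀ j k, π.part j = π.part k ↔ f j = f k) (u : Fin n → ℕ) :
    hNC π (List.ofFn u) = stabCount fun j => (f j, u j) := by
  rw [hNC, NCSeries.sum_apply, Finset.sum_eq_single (ker u)]
  · rw [NCSeries.smul_apply, mNC_ofFn, if_pos rfl, mul_one]
    congr 1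
    refine blockFactorial_eq_stabCount fun j k => ?_
    rw [part_inf_eq_iff, part_ker_eq_iff, hf, Prod.mk.injEq, and_comm]
  · intro σ _ hσ
    rw [NCSeries.smul_apply, mNC_ofFn, if_neg hσ, mul_zero]
  · exact fun h => absurd (Finset.mem_univ _) h

theorem perm_blockFactorial_inf {n : ℕ} (δ : Equiv.Perm (Fin n)) (σ π : SetPartition n) :
    (σ.perm δ ⊓ π.perm δ).blockFactorial = (σ ⊓ π).blockFactorial := by
  have h : σ.perm δ ⊓ π.perm δ = (σ ⊓ π).perm δ := by
    refine ext_part fun j k => ?_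
    obtain ⟨j, rfl⟩ := δ.surjective j
    obtain ⟨k, rfl⟩ := δ.surjective k
    rw [part_inf_eq_iff, part_perm_eq_iff, part_perm_eq_iff, part_perm_eq_iff, part_inf_eq_iff]
  rw [h, blockFactorial, blockFactorial]
  have hp : ((σ ⊓ π).perm δ).parts = (σ ⊓ π).parts.map δ.finsetCongr.toEmbedding := rfl
  rw [hp, Finset.prod_map]
  refine Finset.prod_congr rfl fun B _ => ?_
  simp

theorem permAct_hNC {n : ℕ} (δ : Equiv.Perm (Fin n)) (π : SetPartition n) :
    permAct δ (hNC π) = hNC (π.perm δ) := by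
  rw [hNC, hNC, map_sum]
  refine Finset.sum_bij' (fun σ _ => σ.perm δ) (fun σ _ => σ.perm δ⁻¹)
    (fun _ _ => Finset.mem_univ _) (fun _ _ => Finset.mem_univ _) ?_ ?_ ?_
  · intro σ _
    rw [perm_mul, inv_mul_cancel, perm_one]
  · intro σ _
    rw [perm_mul, mul_inv_cancel, perm_one]
  · intro σ _
    rw [map_smul, permAct_mNC, perm_blockFactorial_inf]

theorem hNC_mem_NCSym {n : ℕ} (π : SetPartition n) : hNC π ∈ NCSym n :=
  Submodule.sum_mem _ fun σ _ => Submodule.smul_mem _ _ (Submodule.subset_span ⟨σ, rfl⟩)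

/-- Every set partition is the set of cycles of some permutation; thus a permutation exists that
preserves the blocks of exactly the coarser partitions. -/
theorem exists_perm_cycles {n : ℕ} (τ : SetPartition n) :
    ∃ g : Equiv.Perm (Fin n), ∀ π : SetPartition n,
      (∀ j, π.part (g j) = π.part j) ↔ τ ≤ π := by
  classical
  choose c hc _ using fun B : Finset (Fin n) => B.exists_cycleOn
  have hmem : ∀ j, j ∈ τ.part j := fun j => τ.mem_part (Finset.mem_univ j)
  have hmaps : ∀ j k, k ∈ τ.part j → c (τ.part j) k ∈ τ.part j := fun j k hk =>
    (hc (τ.part j)).1.mapsTo hk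
  have hpart : ∀ j, τ.part (c (τ.part j) j) = τ.part j := fun j =>
    ((mem_part_iff τ _ _).1 (hmaps j j (hmem j))).symm
  have hinj : Function.Injective fun j => c (τ.part j) j := by
    intro j k h
    have hjk : τ.part j = τ.part k := by
      rw [← hpart j, ← hpart k]
      exact congrArg τ.part h
    simp only [hjk] at h
    exact (c (τ.part k)).injective h
  refine ⟨Equiv.ofBijective _ (Finite.injective_iff_bijective.1 hinj), fun π => ?_⟩
  simp only [Equiv.ofBijective_apply]
  constructor
  · intro h
    have hconst : ∀ j k, k ∈ τ.part j → π.part k = π.part j := by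
      intro j k hk
      obtain ⟨i, -, rfl⟩ := (hc (τ.part j)).exists_pow_eq (hmem j) hk
      clear hk
      have hi : ∀ i : ℕ, (c (τ.part j) ^ i) j ∈ τ.part j ∧
          π.part ((c (τ.part j) ^ i) j) = π.part j := by
        intro i
        induction i with
        | zero => exact ⟨hmem j, rfl⟩
        | succ i ih =>
          rw [pow_succ', Equiv.Perm.mul_apply]
          refine ⟨hmaps j _ ih.1, ?_⟩
          have := h ((c (τ.part j) ^ i) j)
          rwa [← (mem_part_iff τ _ _).1 ih.1, ih.2] at this
      exact (hi i).2
    intro B hB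
    obtain ⟨j, hj⟩ := τ.nonempty_of_mem_parts hB
    refine ⟨π.part j, π.part_mem.2 (Finset.mem_univ j), fun k hk => ?_⟩
    rw [mem_part_iff]
    refine (hconst j k ?_).symm
    rwa [τ.part_eq_of_mem hB hj]
  · intro h j
    obtain ⟨C, hC, hBC⟩ := h (τ.part_mem.2 (Finset.mem_univ j))
    rw [π.part_eq_of_mem hC (hBC (hmem j)), π.part_eq_of_mem hC (hBC (hmaps j j (hmem j)))]

/-- The Gram matrix `λ(σ ∧ π)!` is positive definite: it counts the permutations preserving the
blocks of both `σ` and `π`, so that its quadratic form is a sum of squares over permutations. -/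
theorem linearIndependent_hNC (n : ℕ) :
    LinearIndependent ℚ (fun π : SetPartition n => hNC π) := by
  classical
  rw [Fintype.linearIndependent_iff]
  intro v hv
  have hgram : ∀ σ : SetPartition n,
      ∑ π, v π * (stabCount fun j => (π.part j, σ.part j) : ℚ) = 0 := by
    intro σ
    have h := congrFun hv
      (List.ofFn fun j => ((σ.part j).min' ⟨j, σ.mem_part (Finset.mem_univ j)⟩ : ℕ))
    rw [NCSeries.sum_apply] at h
    rw [← NCSeries.zero_apply, ← h]
    refine Finset.sum_congr rfl fun π _ => ?_
    rw [NCSeries.smul_apply, hNC_ofFn (f := π.part) fun _ _ => Iff.rfl]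
    congr 2
    refine stabCount_congr fun j k => ?_
    rw [Prod.mk.injEq, Prod.mk.injEq]
    refine and_congr_right fun _ => ⟨fun h => by simp only [h], fun h => ?_⟩
    have h := Fin.ext h
    have hj := Finset.min'_mem (σ.part j) ⟨j, σ.mem_part (Finset.mem_univ j)⟩
    have hk := Finset.min'_mem (σ.part k) ⟨k, σ.mem_part (Finset.mem_univ k)⟩
    rw [mem_part_iff] at hj hk
    rw [hj, hk, h]
  have hsq : ∑ g : Equiv.Perm (Fin n),
      (∑ π : SetPartition n, if ∀ j, π.part (g j) = π.part j then v π else 0) ^ 2 = 0 := by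
    have hexp : ∀ σ π : SetPartition n, (stabCount fun j => (π.part j, σ.part j) : ℚ) =
        ∑ g : Equiv.Perm (Fin n), (if ∀ j, π.part (g j) = π.part j then 1 else 0) *
          (if ∀ j, σ.part (g j) = σ.part j then 1 else 0) := by
      intro σ π
      rw [stabCount, Finset.card_filter]
      push_cast
      refine Finset.sum_congr rfl fun g _ => ?_
      rw [ite_zero_mul_ite_zero, mul_one]
      simp only [Prod.mk.injEq, forall_and]
    calc _ = ∑ σ, v σ * ∑ π, v π * (stabCount fun j => (π.part j, σ.part j) : ℚ) := by
          simp only [hexp, sq, Finset.sum_mul, Finset.mul_sum]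
          rw [Finset.sum_comm]
          refine Finset.sum_congr rfl fun σ _ => ?_
          rw [Finset.sum_comm]
          refine Finset.sum_congr rfl fun π _ => Finset.sum_congr rfl fun g _ => ?_
          split_ifs <;> ring
      _ = 0 := Finset.sum_eq_zero fun σ _ => by rw [hgram, mul_zero]
  have hzero : ∀ τ : SetPartition n, ∑ π : SetPartition n, (if τ ≤ π then v π else 0) = 0 := by
    intro τ
    obtain ⟨g, hg⟩ := exists_perm_cycles τ
    have := (Finset.sum_eq_zero_iff_of_nonneg fun g _ => sq_nonneg _).1 hsq g (Finset.mem_univ g)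
    simpa only [hg] using pow_eq_zero_iff two_ne_zero |>.1 this
  intro τ
  induction τ using (wellFounded_gt (α := SetPartition n)).induction with
  | _ τ ih =>
    rw [← hzero τ, Finset.sum_eq_single τ, if_pos le_rfl]
    · intro π _ hπ
      split_ifs with h
      · exact ih π (lt_of_le_of_ne h (Ne.symm hπ))
      · rfl
    · exact fun h => absurd (Finset.mem_univ _) h

/-! ### Products of complete homogeneous functions -/

/-- The product of the factorials of the multiplicities in a multiset. -/
def multFactorial {α : Type*} [DecidableEq α] (s : Multiset α) : ℕ :=
  ∏ x ∈ s.toFinset, (s.count x).factorial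

theorem multFactorial_map {α β : Type*} [DecidableEq α] [DecidableEq β] {f : α → β}
    (hf : Function.Injective f) (s : Multiset α) :
    multFactorial (s.map f) = multFactorial s := by
  rw [multFactorial, multFactorial, Multiset.toFinset_map, Finset.prod_image hf.injOn]
  simp only [Multiset.count_map_eq_count' f _ hf]

theorem multFactorial_add {α : Type*} [DecidableEq α] {s t : Multiset α} (h : Disjoint s t) :
    multFactorial (s + t) = multFactorial s * multFactorial t := by
  rw [Multiset.disjoint_left] at h
  rw [multFactorial, multFactorial, multFactorial, Multiset.toFinset_add, Finset.prod_union]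
  · congr 1 <;> refine Finset.prod_congr rfl fun x hx => ?_ <;> rw [Multiset.mem_toFinset] at hx <;>
      rw [Multiset.count_add]
    · rw [Multiset.count_eq_zero_of_notMem (h hx), add_zero]
    · rw [Multiset.count_eq_zero_of_notMem fun hs => h hs hx, zero_add]
  · rw [Finset.disjoint_left]
    simpa using fun x => @h x

theorem stabCount_eq_multFactorial {n : ℕ} {α : Type*} [DecidableEq α] (f : Fin n → α) :
    stabCount f = multFactorial (List.ofFn f : Multiset α) := by
  rw [stabCount_eq_prod, multFactorial]
  have h : (List.ofFn f : Multiset α) = Finset.univ.val.map f := (Fin.univ_val_map f).symm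
  rw [h, Multiset.toFinset_map, Finset.val_toFinset]
  refine Finset.prod_congr rfl fun x _ => ?_
  rw [Multiset.count_map]
  simp only [eq_comm (a := x)]
  rfl

/-- The series in which a word has as coefficient the number of place permutations that preserve it
together with the labelling `L` of the places; this is `h_π` for the kernel `π` of `L`. -/
def labelSeries (L : List ℕ) : NCSeries := fun w =>
  if w.length = L.length then (multFactorial (L.zip w : Multiset (ℕ × ℕ)) : ℚ) else 0

theorem labelSeries_apply (L w : List ℕ) : labelSeries L w =
    if w.length = L.length then (multFactorial (L.zip w : Multiset (ℕ × ℕ)) : ℚ) else 0 := rfl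

theorem hNC_eq_labelSeries {n : ℕ} {π : SetPartition n} {f : Fin n → ℕ}
    (hf : ∀ j k, π.part j = π.part k ↔ f j = f k) : hNC π = labelSeries (List.ofFn f) := by
  funext w
  rw [labelSeries, List.length_ofFn]
  split_ifs with h
  · obtain ⟨u, rfl⟩ := exists_eq_ofFn h
    rw [hNC_ofFn hf, stabCount_eq_multFactorial]
    congr 3
    refine List.ext_getElem (by simp) fun i _ _ => ?_
    simp
  · exact hNC_of_length_ne π h

theorem hNC_top (k : ℕ) : hNC (⊤ : SetPartition k) = labelSeries (List.replicate k 0) := by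
  rw [← List.ofFn_const]
  exact hNC_eq_labelSeries fun i j => by simp only [part_top_eq i j]

theorem labelSeries_nil : labelSeries [] = 1 := by
  funext w
  rw [labelSeries, NCSeries.one_apply]
  simp only [List.length_nil, List.length_eq_zero_iff]
  split_ifs <;> simp [multFactorial]

theorem labelSeries_replicate_mul (k : ℕ) (L : List ℕ) :
    labelSeries (List.replicate k 0) * labelSeries L =
      labelSeries (List.replicate k 0 ++ L.map Nat.succ) := by
  funext w
  rw [NCSeries.mul_apply]
  simp only [labelSeries_apply, List.length_replicate, List.length_append, List.length_map,
    List.length_take, List.length_drop]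
  split_ifs with h
  · rw [Finset.sum_eq_single k]
    · rw [if_pos (by omega), if_pos (by omega), ← Nat.cast_mul]
      congr 1
      have hmap : (L.map Nat.succ).zip (w.drop k) =
          (L.zip (w.drop k)).map (Prod.map Nat.succ id) := by
        rw [← List.zip_map, List.map_id]
      conv_rhs => rw [← List.take_append_drop k w,
        List.zip_append (by simp; omega), hmap, ← Multiset.coe_add, ← Multiset.map_coe]
      rw [multFactorial_add, multFactorial_map]
      · exact Prod.map_injective.2 ⟨Nat.succ_injective, Function.injective_id⟩
      · rw [Multiset.disjoint_left]
        rintro ⟨a, x⟩ h₁ h₂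
        have h₁ := List.eq_of_mem_replicate (List.of_mem_zip (Multiset.mem_coe.1 h₁)).1
        obtain ⟨p, -, hp⟩ := Multiset.mem_map.1 h₂
        exact Nat.succ_ne_zero p.1 ((congrArg Prod.fst hp).trans h₁)
    · intro i hi hik
      rw [Finset.mem_range] at hi
      rw [if_neg (by omega), zero_mul]
    · intro hk
      exact absurd (Finset.mem_range.2 (by omega)) hk
  · refine Finset.sum_eq_zero fun i hi => ?_
    rw [Finset.mem_range] at hi
    by_cases h₁ : min i w.length = k
    · rw [if_neg (c := w.length - i = L.length) (by omega), mul_zero]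
    · rw [if_neg h₁, zero_mul]

/-- The word `0⋯0 1⋯1 2⋯2 ⋯` whose runs have the lengths `ks`. -/
def runLabels : List ℕ → List ℕ
  | [] => []
  | k :: ks => List.replicate k 0 ++ (runLabels ks).map Nat.succ

theorem length_runLabels (ks : List ℕ) : (runLabels ks).length = ks.sum := by
  induction ks with
  | nil => rfl
  | cons k ks ih => simp [runLabels, ih]

theorem prod_hRow_nat (ks : List ℕ) :
    (ks.map fun k : ℕ => hRow k).prod =
      (ks.map fun k => 1 / (k.factorial : ℚ)).prod • labelSeries (runLabels ks) := by
  induction ks with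
  | nil => exact (labelSeries_nil.symm.trans (one_smul ℚ _).symm)
  | cons k ks ih =>
    have hk : hRow (k : ℤ) = (1 / (k.factorial : ℚ)) • labelSeries (List.replicate k 0) := by
      rw [hRow, if_pos (Int.natCast_nonneg k), ← hNC_top]
      rfl
    rw [List.map_cons, List.prod_cons, ih, hk, NCSeries.smul_mul_smul, labelSeries_replicate_mul,
      List.map_cons, List.prod_cons, runLabels]

theorem prod_hRow_of_neg {ks : List ℤ} (h : ∃ k ∈ ks, k < 0) : (ks.map hRow).prod = 0 := by
  induction ks with
  | nil => simp at h
  | cons k ks ih =>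
    rw [List.map_cons, List.prod_cons]
    obtain ⟨m, hm, hneg⟩ := h
    rcases List.mem_cons.1 hm with rfl | hm
    · rw [hRow, if_neg (not_le.2 hneg), NCSeries.zero_mul]
    · rw [ih ⟨m, hm, hneg⟩, NCSeries.mul_zero]

/-! ### The commutative image of `h_{[k]}` -/

theorem ofFn_perm_iff {n : ℕ} (u v : Fin n → ℕ) :
    (List.ofFn u).Perm (List.ofFn v) ↔ ∃ g : Equiv.Perm (Fin n), u ∘ g = v := by
  constructor
  · intro h
    have hsort : u ∘ Tuple.sort u = v ∘ Tuple.sort v :=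
      List.ofFn_injective <|
        ((((Tuple.sort u).ofFn_comp_perm u).trans h).trans
          ((Tuple.sort v).ofFn_comp_perm v).symm).eq_of_pairwise'
        (Tuple.monotone_sort u).sortedLE_ofFn.pairwise
        (Tuple.monotone_sort v).sortedLE_ofFn.pairwise
    refine ⟨Tuple.sort u * (Tuple.sort v)⁻¹, funext fun j => ?_⟩
    have := congrFun hsort ((Tuple.sort v)⁻¹ j)
    simpa using this
  · rintro ⟨g, rfl⟩
    exact (g.ofFn_comp_perm u).symm

/-- Orbit counting: the stabilizers of the rearrangements of a word of length `k` have `k!` elements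
in total. -/
theorem sum_multFactorial_wordsOf (d : ℕ →₀ ℕ) :
    ∑ w ∈ wordsOf d, multFactorial (w : Multiset ℕ) = d.degree.factorial := by
  obtain ⟨w₀, hw₀⟩ := Quot.exists_rep (Finsupp.toMultiset d)
  have hw₀ : (w₀ : Multiset ℕ) = Finsupp.toMultiset d := hw₀
  have hlen : w₀.length = d.degree := by
    rw [← Multiset.coe_card, hw₀, Finsupp.card_toMultiset]
    rfl
  obtain ⟨u, rfl⟩ := exists_eq_ofFn hlen
  have hcard : (Finset.univ : Finset (Equiv.Perm (Fin d.degree))).card = d.degree.factorial := by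
    rw [Finset.card_univ, Fintype.card_perm, Fintype.card_fin]
  rw [← hcard, Finset.card_eq_sum_card_fiberwise (t := wordsOf d)
    (f := fun g : Equiv.Perm (Fin d.degree) => List.ofFn (u ∘ g))]
  · refine Finset.sum_congr rfl fun w hw => ?_
    rw [mem_wordsOf, ← hw₀, Multiset.coe_eq_coe] at hw
    obtain ⟨v, rfl⟩ := exists_eq_ofFn (hw.length_eq.trans List.length_ofFn)
    obtain ⟨g, rfl⟩ := (ofFn_perm_iff u v).1 hw.symm
    rw [← stabCount_eq_multFactorial, stabCount]
    refine Finset.card_bij' (fun a _ => g * a) (fun b _ => g⁻¹ * b) ?_ ?_ ?_ ?_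
    · intro a ha
      simpa [List.ofFn_inj, funext_iff] using ha
    · intro b hb
      simpa [List.ofFn_inj, funext_iff] using hb
    · intro a _
      simp
    · intro b _
      simp
  · intro g _
    rw [Finset.mem_coe, mem_wordsOf, ← hw₀]
    exact Multiset.coe_eq_coe.2 (g.ofFn_comp_perm u)

theorem rho_hNC_top (k : ℕ) : rho (hNC (⊤ : SetPartition k)) = (k.factorial : ℚ) • hSym k := by
  ext d
  rw [rho_apply, map_smul, hNC_top]
  have hlen : ∀ w ∈ wordsOf d, w.length = d.degree := by
    intro w hw
    rw [← Multiset.coe_card, (mem_wordsOf d w).1 hw, Finsupp.card_toMultiset]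
    rfl
  have hS : MvPowerSeries.coeff d (hSym k) = if (d.degree : ℤ) = k then 1 else 0 := rfl
  rw [hS]
  simp only [Nat.cast_inj]
  split_ifs with hd
  · rw [smul_eq_mul, mul_one, ← hd, ← sum_multFactorial_wordsOf, Nat.cast_sum]
    refine Finset.sum_congr rfl fun w hw => ?_
    have hzip : (List.replicate w.length 0).zip w = w.map (Prod.mk 0) := by
      refine List.ext_getElem (by simp) fun i _ _ => ?_
      simp
    rw [labelSeries, List.length_replicate, if_pos (hlen w hw), ← hlen w hw, hzip,
      ← Multiset.map_coe, multFactorial_map (Prod.mk_right_injective 0)]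
  · rw [smul_zero]
    refine Finset.sum_eq_zero fun w hw => ?_
    rw [labelSeries, if_neg]
    rwa [List.length_replicate, hlen w hw]

theorem rho_hRow (k : ℤ) : rho (hRow k) = hSym k := by
  rw [hRow]
  split_ifs with hk
  · have hfac : (k.toNat.factorial : ℚ) ≠ 0 := Nat.cast_ne_zero.2 (Nat.factorial_ne_zero _)
    rw [map_smul, rho_hNC_top, smul_smul, one_div, inv_mul_cancel₀ hfac, one_smul,
      Int.toNat_of_nonneg hk]
  · rw [map_zero]
    ext d
    have hS : MvPowerSeries.coeff d (hSym k) = if (d.degree : ℤ) = k then 1 else 0 := rfl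
    rw [hS, if_neg (by omega), map_zero]

theorem rho_schurNC {n : ℕ} (π : SetPartition n) : rho (schurNC π) = schur π.shape := by
  rw [schurNC, rho_permAct, sourceSchur, rho_ncDet, schur]
  exact congrArg Matrix.det (Matrix.ext fun i j => rho_hRow _)

/-! ### The expansion of Schur functions in the complete homogeneous basis is triangular -/

namespace SetPartition

variable {n : ℕ}

/-- The number of pairs of positions in a common block, equivalently the sum of the squares of the
block sizes. It grows with the shape in dominance order. -/
def coincidences (σ : SetPartition n) : ℕ :=
  ∑ j, (Finset.univ.filter fun k => σ.part k = σ.part j).card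

theorem coincidences_perm (δ : Equiv.Perm (Fin n)) (σ : SetPartition n) :
    (σ.perm δ).coincidences = σ.coincidences := by
  rw [coincidences, coincidences, ← Equiv.sum_comp δ]
  refine Finset.sum_congr rfl fun j _ => ?_
  conv_rhs => rw [← Finset.card_map δ.toEmbedding]
  congr 1
  ext k
  obtain ⟨k, rfl⟩ := δ.surjective k
  simp [part_perm_eq_iff]

theorem coincidences_ker (f : Fin n → ℕ) :
    (ker f).coincidences = ((List.ofFn f).map fun x => (List.ofFn f).count x).sum := by
  rw [List.map_ofFn, List.sum_ofFn, coincidences]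
  refine Finset.sum_congr rfl fun j _ => ?_
  simp only [part_ker_eq_iff, Function.comp_apply]
  rw [← Multiset.coe_count, ← Fin.univ_val_map, Multiset.count_map]
  simp only [eq_comm (a := f j)]
  rfl

end SetPartition

/-- The set partition of the positions `0, …, n - 1` into consecutive intervals of lengths `ks`, for
`n` the sum of `ks`. -/
noncomputable def runPartition (n : ℕ) (ks : List ℕ) : SetPartition n :=
  ker fun j : Fin n => (runLabels ks).getD j 0

theorem ofFn_getD_runLabels {n : ℕ} {ks : List ℕ} (h : ks.sum = n) :
    (List.ofFn fun j : Fin n => (runLabels ks).getD j 0) = runLabels ks := by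
  rw [← length_runLabels] at h
  subst h
  refine List.ext_getElem (by simp) fun i _ h => ?_
  simp

theorem labelSeries_runLabels {n : ℕ} {ks : List ℕ} (h : ks.sum = n) :
    labelSeries (runLabels ks) = hNC (runPartition n ks) := by
  rw [runPartition, hNC_eq_labelSeries (part_ker_eq_iff _), ofFn_getD_runLabels h]

theorem coincidences_runPartition {n : ℕ} {ks : List ℕ} (h : ks.sum = n) :
    (runPartition n ks).coincidences = (ks.map fun k => k ^ 2).sum := by
  rw [runPartition, coincidences_ker, ofFn_getD_runLabels h]
  clear h
  induction ks with
  | nil => rfl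
  | cons k ks ih =>
    rw [runLabels, List.map_append, List.sum_append, List.map_cons, List.sum_cons, ← ih]
    congr 1
    · rw [List.map_replicate, List.sum_replicate, List.count_append, List.count_replicate_self,
        List.count_eq_zero_of_not_mem (by simp), add_zero, smul_eq_mul, sq]
    · rw [List.map_map]
      congr 1
      refine List.map_congr_left fun x _ => ?_
      rw [Function.comp_apply, List.count_append,
        List.count_map_of_injective _ _ Nat.succ_injective,
        List.count_eq_zero_of_not_mem, zero_add]
      exact fun hx => Nat.succ_ne_zero x (List.eq_of_mem_replicate hx)

/-- The row lengths `r_i - i + ε(i)` occurring in the Leibniz expansion of a Jacobi–Trudi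
determinant. -/
def shiftedRows (r : List ℕ) (ε : Equiv.Perm (Fin r.length)) : List ℤ :=
  List.ofFn fun i => (r.get i : ℤ) - (i : ℤ) + (ε i : ℤ)

theorem shiftedRows_one (r : List ℕ) : shiftedRows r 1 = r.map fun k : ℕ => (k : ℤ) := by
  refine List.ext_getElem (by simp [shiftedRows]) fun i _ _ => ?_
  simp [shiftedRows]

theorem sum_shiftedRows (r : List ℕ) (ε : Equiv.Perm (Fin r.length)) :
    (shiftedRows r ε).sum = r.sum := by
  have hr : (r.sum : ℤ) = ∑ i, (r.get i : ℤ) := by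
    conv_lhs => rw [← List.ofFn_get r, List.sum_ofFn]
    push_cast
    rfl
  rw [shiftedRows, List.sum_ofFn, Finset.sum_add_distrib, Finset.sum_sub_distrib,
    Equiv.sum_comp ε fun i => (i : ℤ), hr]
  ring

/-- By the rearrangement inequality, applied to the strictly decreasing sequence `r_i - i`, every
nonidentity term of the Jacobi–Trudi determinant has row lengths with a larger sum of squares. -/
theorem sum_sq_lt_sum_sq_shiftedRows {r : List ℕ} (hr : r.Pairwise (· ≥ ·))
    {ε : Equiv.Perm (Fin r.length)} (hε : ε ≠ 1) :
    (((r.map fun k => k ^ 2).sum : ℕ) : ℤ) < ((shiftedRows r ε).map fun k => k ^ 2).sum := by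
  set f : Fin r.length → ℤ := fun i => (r.get i : ℤ) - (i : ℤ) with hf
  set g : Fin r.length → ℤ := fun i => (i : ℤ) with hg
  have hanti : StrictAnti f := by
    intro i j hij
    have h₁ : r.get j ≤ r.get i := List.pairwise_iff_get.1 hr i j hij
    have h₂ : (i : ℕ) < j := hij
    simp only [hf]
    omega
  have hfg : Antivary f g := by
    intro i j hij
    exact (hanti (Fin.lt_def.2 (Int.ofNat_lt.1 hij))).le
  have hlt : ∑ i, f i * g i < ∑ i, f i * g (ε i) := by
    refine hfg.sum_mul_lt_sum_mul_comp_perm_iff.2 fun hcon => hε ?_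
    refine (Equiv.Perm.monotone_iff ε).1 fun i j hij => ?_
    by_contra hlt
    rcases hij.lt_or_eq with hij | rfl
    · exact absurd (hcon (Int.ofNat_lt.2 (Fin.lt_def.1 (not_le.1 hlt)))) (not_le.2 (hanti hij))
    · exact hlt le_rfl
  have hsq : ∑ i, g (ε i) ^ 2 = ∑ i, g i ^ 2 := Equiv.sum_comp ε fun i => g i ^ 2
  have h₁ : (((r.map fun k => k ^ 2).sum : ℕ) : ℤ) = ∑ i, (f i + g i) ^ 2 := by
    conv_lhs => rw [← List.ofFn_get r, List.map_ofFn, List.sum_ofFn]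
    push_cast
    refine Finset.sum_congr rfl fun i _ => ?_
    simp [hf, hg]
  have h₂ : ((shiftedRows r ε).map fun k => k ^ 2).sum = ∑ i, (f i + g (ε i)) ^ 2 := by
    rw [shiftedRows, List.map_ofFn, List.sum_ofFn]
    rfl
  rw [h₁, h₂]
  simp only [add_sq, Finset.sum_add_distrib, hsq, mul_assoc, ← Finset.mul_sum]
  linarith

/-- The noncommutative Jacobi–Trudi determinant with row lengths `r`. -/
def jacobiTrudi (r : List ℕ) : NCSeries :=
  ncDet (Matrix.of fun i j : Fin r.length => hRow ((r.get i : ℤ) - (i : ℤ) + (j : ℤ)))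

theorem jacobiTrudi_eq_sum (r : List ℕ) : jacobiTrudi r =
    ∑ ε : Equiv.Perm (Fin r.length),
      ((Equiv.Perm.sign ε : ℤ) : ℚ) • ((shiftedRows r ε).map hRow).prod := by
  simp only [shiftedRows, List.map_ofFn]
  rfl

theorem prod_inv_factorial_ne_zero (ks : List ℕ) :
    (ks.map fun k => 1 / (k.factorial : ℚ)).prod ≠ 0 := by
  refine List.prod_ne_zero ?_
  simp [Nat.factorial_ne_zero]

theorem prod_hRow_eq_smul_hNC {n : ℕ} {ks : List ℕ} (h : ks.sum = n) :
    ((ks.map fun k : ℕ => (k : ℤ)).map hRow).prod =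
      (ks.map fun k => 1 / (k.factorial : ℚ)).prod • hNC (runPartition n ks) := by
  rw [← labelSeries_runLabels h, ← prod_hRow_nat, List.map_map]
  rfl

/-- A term of the Jacobi–Trudi determinant is a multiple of a single `h_τ`; it vanishes when a row
length is negative, and then `τ` is immaterial. -/
theorem jacobiTrudi_term {r : List ℕ} (hr : r.Pairwise (· ≥ ·)) (ε : Equiv.Perm (Fin r.length)) :
    ∃ (q : ℚ) (τ : SetPartition r.sum),
      ((Equiv.Perm.sign ε : ℤ) : ℚ) • ((shiftedRows r ε).map hRow).prod = q • hNC τ ∧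
      (ε = 1 → τ = runPartition r.sum r ∧ q ≠ 0) ∧
      (ε ≠ 1 → q ≠ 0 → (runPartition r.sum r).coincidences < τ.coincidences) := by
  by_cases hneg : ∃ k ∈ shiftedRows r ε, k < 0
  · refine ⟨0, ⊤, ?_, ?_, fun _ h => absurd rfl h⟩
    · rw [prod_hRow_of_neg hneg, smul_zero, zero_smul]
    · rintro rfl
      obtain ⟨k, hk, hk0⟩ := hneg
      rw [shiftedRows_one, List.mem_map] at hk
      obtain ⟨m, -, rfl⟩ := hk
      omega
  · push Not at hneg
    obtain ⟨ks, hks⟩ : ∃ ks : List ℕ, ks.map (fun k : ℕ => (k : ℤ)) = shiftedRows r ε := by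
      refine ⟨(shiftedRows r ε).map Int.toNat, ?_⟩
      rw [List.map_map]
      conv_rhs => rw [← List.map_id (shiftedRows r ε)]
      exact List.map_congr_left fun k hk => Int.toNat_of_nonneg (hneg k hk)
    have hsum : ks.sum = r.sum := by
      have h := sum_shiftedRows r ε
      rw [← hks] at h
      have hcast : ((ks.sum : ℕ) : ℤ) = (ks.map fun k : ℕ => (k : ℤ)).sum := by
        induction ks <;> simp
      exact_mod_cast hcast.trans h
    have hsign : ((Equiv.Perm.sign ε : ℤ) : ℚ) ≠ 0 := by
      exact_mod_cast (Equiv.Perm.sign ε).ne_zero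
    refine ⟨((Equiv.Perm.sign ε : ℤ) : ℚ) * (ks.map fun k => 1 / (k.factorial : ℚ)).prod,
      runPartition r.sum ks, ?_, ?_, ?_⟩
    · rw [← hks, prod_hRow_eq_smul_hNC hsum, smul_smul]
    · rintro rfl
      rw [shiftedRows_one] at hks
      have : ks = r := (List.map_injective_iff.2 Nat.cast_injective) hks
      exact ⟨by rw [this], mul_ne_zero hsign (prod_inv_factorial_ne_zero ks)⟩
    · intro hε _
      rw [coincidences_runPartition hsum, coincidences_runPartition rfl]
      have h := sum_sq_lt_sum_sq_shiftedRows hr hε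
      rw [← hks] at h
      have hcast : (((ks.map fun k => k ^ 2).sum : ℕ) : ℤ) =
          ((ks.map fun k : ℕ => (k : ℤ)).map fun k => k ^ 2).sum := by
        clear h hks hsum
        induction ks <;> simp_all
      exact_mod_cast hcast ▸ h

theorem exists_jacobiTrudi_expansion {n : ℕ} {r : List ℕ} (hr : r.Pairwise (· ≥ ·))
    (hn : r.sum = n) (δ : Equiv.Perm (Fin n)) :
    ∃ a : SetPartition n → ℚ, permAct δ (jacobiTrudi r) = ∑ τ, a τ • hNC τ ∧
      a ((runPartition n r).perm δ) ≠ 0 ∧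
      ∀ τ, a τ ≠ 0 → τ = (runPartition n r).perm δ ∨
        ((runPartition n r).perm δ).coincidences < τ.coincidences := by
  classical
  subst hn
  choose q τ hterm hone hlt using jacobiTrudi_term hr
  have hlt' : ∀ ε, ε ≠ 1 → q ε ≠ 0 →
      ((runPartition r.sum r).perm δ).coincidences < ((τ ε).perm δ).coincidences := by
    intro ε hε hq
    rw [coincidences_perm, coincidences_perm]
    exact hlt ε hε hq
  refine ⟨fun σ => ∑ ε, if (τ ε).perm δ = σ then q ε else 0, ?_, ?_, ?_⟩
  · rw [jacobiTrudi_eq_sum, map_sum]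
    simp only [Finset.sum_smul]
    rw [Finset.sum_comm]
    refine Finset.sum_congr rfl fun ε _ => ?_
    rw [hterm, map_smul, permAct_hNC, Finset.sum_eq_single ((τ ε).perm δ), if_pos rfl]
    · intro σ _ hσ
      rw [if_neg hσ.symm, zero_smul]
    · exact fun h => absurd (Finset.mem_univ _) h
  · beta_reduce
    rw [Finset.sum_eq_single 1, if_pos (by rw [(hone 1 rfl).1])]
    · exact (hone 1 rfl).2
    · intro ε _ hε
      split_ifs with h
      · by_contra hq
        have := hlt' ε hε hq
        rw [h] at this
        exact lt_irrefl _ this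
      · rfl
    · exact fun h => absurd (Finset.mem_univ _) h
  · intro σ hσ
    obtain ⟨ε, -, hε⟩ := Finset.exists_ne_zero_of_sum_ne_zero hσ
    have hτ : (τ ε).perm δ = σ := by
      by_contra h
      exact hε (if_neg h)
    rw [if_pos hτ] at hε
    by_cases h1 : ε = 1
    · left
      rw [← hτ, (hone ε h1).1]
    · right
      rw [← hτ]
      exact hlt' ε h1 hε

/-! ### The reading permutation sends the consecutive intervals to the blocks -/

theorem rows_pairwise {n : ℕ} (lam : Nat.Partition n) : (rows lam).Pairwise (· ≥ ·) :=
  Multiset.pairwise_sort _ _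

theorem rows_eq_of_pairwise {n : ℕ} {lam : Nat.Partition n} {l : List ℕ}
    (hl : l.Pairwise (· ≥ ·)) (h : (l : Multiset ℕ) = lam.parts) : rows lam = l := by
  refine List.Perm.eq_of_pairwise' (rows_pairwise lam) hl (Multiset.coe_eq_coe.1 ?_)
  rw [rows, Multiset.sort_eq, h]

theorem sum_rows {n : ℕ} (lam : Nat.Partition n) : (rows lam).sum = n := by
  rw [← Multiset.sum_coe, rows, Multiset.sort_eq, lam.parts_sum]

/-- The key that orders the rows of the tableau: larger rows first, rows of equal size by least
entry. -/
def rowKey {n : ℕ} (B : Finset (Fin n)) : ℕᵒᵈ ×ₗ WithTop (Fin n) :=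
  toLex (OrderDual.toDual B.card, B.min)

theorem readingKey_le {n : ℕ} (π : SetPartition n) {a b : Fin n}
    (h : rowKey (π.part a) < rowKey (π.part b) ∨ π.part a = π.part b ∧ a ≤ b) :
    readingKey π a ≤ readingKey π b := by
  rw [readingKey, readingKey, Prod.Lex.toLex_le_toLex, Prod.Lex.toLex_le_toLex]
  rcases h with h | ⟨h, hab⟩
  · rw [rowKey, rowKey, Prod.Lex.toLex_lt_toLex] at h
    rcases h with h | ⟨h₁, h₂⟩
    · exact Or.inl h
    · exact Or.inr ⟨h₁, Or.inl h₂⟩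
  · exact Or.inr ⟨by rw [h], Or.inr ⟨by rw [h], hab⟩⟩

theorem readingKey_injective {n : ℕ} (π : SetPartition n) :
    Function.Injective (readingKey π) := fun _ _ h =>
  congrArg (fun x => (ofLex (ofLex x).2).2) h

theorem monotone_readingKey {n : ℕ} (π : SetPartition n) :
    Monotone (readingKey π ∘ readingPerm π) :=
  Tuple.monotone_sort _

/-- The rows of the tableau attached to `π`, from top to bottom. -/
noncomputable def tableauRows {n : ℕ} (π : SetPartition n) : List (Finset (Fin n)) :=
  π.parts.toList.insertionSort fun A B => rowKey A ≤ rowKey B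

section tableau

variable {n : ℕ} (π : SetPartition n)

theorem tableauRows_perm : (tableauRows π).Perm π.parts.toList :=
  List.perm_insertionSort _ _

theorem mem_tableauRows {B : Finset (Fin n)} : B ∈ tableauRows π ↔ B ∈ π.parts := by
  rw [(tableauRows_perm π).mem_iff, Finset.mem_toList]

theorem tableauRows_nodup : (tableauRows π).Nodup :=
  (tableauRows_perm π).nodup_iff.2 (Finset.nodup_toList _)

theorem tableauRows_pairwise :
    (tableauRows π).Pairwise fun A B => rowKey A ≤ rowKey B :=
  haveI : Std.Total fun A B : Finset (Fin n) => rowKey A ≤ rowKey B :=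
    ⟨fun _ _ => le_total _ _⟩
  haveI : IsTrans (Finset (Fin n)) fun A B => rowKey A ≤ rowKey B :=
    ⟨fun _ _ _ => le_trans⟩
  List.pairwise_insertionSort _ _

theorem rowKey_injOn : Set.InjOn rowKey (π.parts : Set (Finset (Fin n))) := by
  intro A hA B hB h
  obtain ⟨a, ha⟩ := Finset.min_of_nonempty (π.nonempty_of_mem_parts hA)
  have hmin : A.min = B.min := congrArg (fun x => (ofLex x).2) h
  exact π.eq_of_mem_parts hA hB (Finset.mem_of_min ha) (Finset.mem_of_min (hmin ▸ ha))

theorem map_card_tableauRows : (tableauRows π).map Finset.card = rows π.shape := by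
  refine (rows_eq_of_pairwise ?_ ?_).symm
  · rw [List.pairwise_map]
    refine (tableauRows_pairwise π).imp fun {A B} h => ?_
    rw [rowKey, rowKey, Prod.Lex.toLex_le_toLex] at h
    rcases h with h | ⟨h, -⟩
    · exact (OrderDual.toDual_lt_toDual.1 h).le
    · exact (OrderDual.toDual_inj.1 h).ge
  · rw [← Multiset.map_coe, Multiset.coe_eq_coe.2 (tableauRows_perm π), Finset.coe_toList]
    rfl

/-- The one-line notation of the reading permutation lists the rows of the tableau, each in
increasing order. -/
theorem ofFn_readingPerm :
    List.ofFn (readingPerm π) = ((tableauRows π).map fun B => B.sort (· ≤ ·)).flatten := by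
  have hsorted : ((tableauRows π).map fun B => B.sort (· ≤ ·)).flatten.Pairwise
      fun a b => readingKey π a ≤ readingKey π b := by
    rw [List.pairwise_flatten]
    constructor
    · intro l hl
      obtain ⟨B, hB, rfl⟩ := List.mem_map.1 hl
      rw [mem_tableauRows] at hB
      refine (B.pairwise_sort (· ≤ ·)).imp_of_mem fun {a b} ha hb hab => readingKey_le π (Or.inr ?_)
      rw [Finset.mem_sort] at ha hb
      exact ⟨(π.part_eq_of_mem hB ha).trans (π.part_eq_of_mem hB hb).symm, hab⟩
    · rw [List.pairwise_map]
      refine ((tableauRows_pairwise π).and (tableauRows_nodup π)).imp_of_mem ?_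
      intro A B hA hB h a ha b hb
      rw [mem_tableauRows] at hA hB
      rw [Finset.mem_sort] at ha hb
      refine readingKey_le π (Or.inl ?_)
      rw [π.part_eq_of_mem hA ha, π.part_eq_of_mem hB hb]
      exact lt_of_le_of_ne h.1 fun hkey => h.2 (rowKey_injOn π hA hB hkey)
  have hnodup : ((tableauRows π).map fun B => B.sort (· ≤ ·)).flatten.Nodup := by
    rw [List.nodup_flatten]
    constructor
    · intro l hl
      obtain ⟨B, -, rfl⟩ := List.mem_map.1 hl
      exact B.sort_nodup _
    · rw [List.pairwise_map]
      refine (tableauRows_nodup π).imp_of_mem fun {A B} hA hB hAB => ?_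
      rw [mem_tableauRows] at hA hB
      intro a ha hb
      rw [Finset.mem_sort] at ha hb
      exact hAB (π.eq_of_mem_parts hA hB ha hb)
  have hperm : (List.ofFn (readingPerm π)).Perm
      ((tableauRows π).map fun B => B.sort (· ≤ ·)).flatten := by
    refine (List.perm_ext_iff_of_nodup
      (List.nodup_ofFn.2 (readingPerm π).injective) hnodup).2 fun a => ?_
    constructor
    · intro _
      rw [List.mem_flatten]
      refine ⟨_, List.mem_map.2 ⟨π.part a, ?_, rfl⟩, ?_⟩
      · rw [mem_tableauRows]
        exact π.part_mem.2 (Finset.mem_univ a)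
      · rw [Finset.mem_sort]
        exact π.mem_part (Finset.mem_univ a)
    · intro _
      exact List.mem_ofFn.2 ((readingPerm π).surjective a)
  refine List.Perm.eq_of_pairwise (le := fun a b => readingKey π a ≤ readingKey π b) ?_ ?_
    hsorted hperm
  · intro a b _ _ h₁ h₂
    exact readingKey_injective π (le_antisymm h₁ h₂)
  · exact List.pairwise_ofFn.2 fun i j hij => monotone_readingKey π hij.le

end tableau

theorem getElem?_of_mem_zip_runLabels {α : Type*} (Bs : List (List α)) {p : ℕ × α}
    (hp : p ∈ (runLabels (Bs.map List.length)).zip Bs.flatten) :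
    ∃ B, Bs[p.1]? = some B ∧ p.2 ∈ B := by
  induction Bs generalizing p with
  | nil => simp [runLabels] at hp
  | cons B Bs ih =>
    rw [List.map_cons, runLabels, List.flatten_cons, List.zip_append (by simp),
      List.mem_append] at hp
    rcases hp with hp | hp
    · have h := List.of_mem_zip hp
      refine ⟨B, ?_, h.2⟩
      rw [List.eq_of_mem_replicate h.1]
      rfl
    · rw [List.zip_map_left] at hp
      obtain ⟨q, hq, rfl⟩ := List.mem_map.1 hp
      exact ih hq

/-- The reading permutation carries the intervals of lengths `λ(π)` to the blocks of `π`. -/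
theorem runPartition_perm_readingPerm {n : ℕ} (π : SetPartition n) :
    (runPartition n (rows π.shape)).perm (readingPerm π) = π := by
  have hlen : ((tableauRows π).map fun B => B.sort (· ≤ ·)).map List.length = rows π.shape := by
    rw [List.map_map, ← map_card_tableauRows]
    exact List.map_congr_left fun B _ => B.length_sort _
  have hblock : ∀ j : Fin n, (tableauRows π)[(runLabels (rows π.shape)).getD j 0]? =
      some (π.part (readingPerm π j)) := by
    intro j
    have hj : (j : ℕ) < (runLabels (rows π.shape)).length := by
      rw [length_runLabels, sum_rows]
      exact j.2
    have hmem : ((runLabels (rows π.shape)).getD j 0, readingPerm π j) ∈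
        (runLabels (rows π.shape)).zip (List.ofFn (readingPerm π)) := by
      refine List.mem_iff_getElem.2 ⟨j, by simpa using hj, ?_⟩
      simp [hj]
    rw [ofFn_readingPerm] at hmem
    nth_rw 1 [← hlen] at hmem
    obtain ⟨B, hB, hjB⟩ := getElem?_of_mem_zip_runLabels _ hmem
    rw [List.getElem?_map, Option.map_eq_some_iff] at hB
    obtain ⟨C, hC, rfl⟩ := hB
    rw [Finset.mem_sort] at hjB
    rw [hC, π.part_eq_of_mem ((mem_tableauRows π).1 (List.mem_of_getElem? hC)) hjB]
  refine ext_part fun j k => ?_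
  obtain ⟨j, rfl⟩ := (readingPerm π).surjective j
  obtain ⟨k, rfl⟩ := (readingPerm π).surjective k
  rw [part_perm_eq_iff, runPartition, part_ker_eq_iff]
  constructor
  · intro h
    have hj := hblock j
    rw [h, hblock k, Option.some_inj] at hj
    exact hj.symm
  · intro h
    have hj := hblock j
    rw [h, ← hblock k] at hj
    refine (List.getElem?_inj ?_ (tableauRows_nodup π)).1 hj
    exact (List.getElem?_eq_some_iff.1 (hj.trans (hblock k))).1

/-- Triangularity: up to a nonzero factor `s_π` is `h_π` plus a combination of functions `h_τ`
with more coincidences. -/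
theorem exists_schurNC_expansion (n : ℕ) :
    ∃ a : SetPartition n → SetPartition n → ℚ, ∀ π, schurNC π = ∑ τ, a π τ • hNC τ ∧
      a π π ≠ 0 ∧ ∀ τ, a π τ ≠ 0 → τ = π ∨ π.coincidences < τ.coincidences := by
  have h : ∀ π : SetPartition n, ∃ a : SetPartition n → ℚ, schurNC π = ∑ τ, a τ • hNC τ ∧
      a π ≠ 0 ∧ ∀ τ, a τ ≠ 0 → τ = π ∨ π.coincidences < τ.coincidences := by
    intro π
    have := exists_jacobiTrudi_expansion (rows_pairwise π.shape) (sum_rows π.shape)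
      (readingPerm π)
    rwa [runPartition_perm_readingPerm] at this
  choose a ha using h
  exact ⟨a, ha⟩

theorem linearIndependent_schurNC (n : ℕ) :
    LinearIndependent ℚ (fun π : SetPartition n => schurNC π) := by
  obtain ⟨a, ha⟩ := exists_schurNC_expansion n
  rw [Fintype.linearIndependent_iff]
  intro v hv
  have hcoef : ∀ τ, ∑ π, v π * a π τ = 0 := by
    refine Fintype.linearIndependent_iff.1 (linearIndependent_hNC n) _ ?_
    rw [← hv]
    simp only [Finset.sum_smul, mul_smul]
    rw [Finset.sum_comm]
    refine Finset.sum_congr rfl fun π _ => ?_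
    rw [(ha π).1, Finset.smul_sum]
  intro τ
  induction hm : τ.coincidences using Nat.strong_induction_on generalizing τ with
  | _ m ih =>
    have h := hcoef τ
    rw [Finset.sum_eq_single τ] at h
    · exact (mul_eq_zero.1 h).resolve_right (ha τ).2.1
    · intro π _ hπ
      by_cases haπ : a π τ = 0
      · rw [haπ, mul_zero]
      · rcases (ha π).2.2 τ haπ with h | h
        · exact absurd h.symm hπ
        · rw [ih _ (hm ▸ h) π rfl, zero_mul]
    · exact fun h => absurd (Finset.mem_univ _) h

theorem permAct_mem_NCSym {n : ℕ} (δ : Equiv.Perm (Fin n)) {f : NCSeries} (hf : f ∈ NCSym n) :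
    permAct δ f ∈ NCSym n := by
  have h : NCSym n ≤ (NCSym n).comap (permAct δ) := by
    refine Submodule.span_le.2 ?_
    rintro _ ⟨π, rfl⟩
    rw [SetLike.mem_coe, Submodule.mem_comap]
    dsimp only
    rw [permAct_mNC]
    exact Submodule.subset_span ⟨_, rfl⟩
  exact h hf

theorem schurNC_mem_NCSym {n : ℕ} (π : SetPartition n) : schurNC π ∈ NCSym n := by
  obtain ⟨a, ha⟩ := exists_schurNC_expansion n
  rw [(ha π).1]
  exact Submodule.sum_mem _ fun τ _ => Submodule.smul_mem _ _ (hNC_mem_NCSym τ)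

theorem linearIndependent_permAct_schurNC {n : ℕ} (δ : Equiv.Perm (Fin n)) :
    LinearIndependent ℚ (fun π : SetPartition n => permAct δ (schurNC π)) :=
  (linearIndependent_schurNC n).map' (permAct δ)
    (LinearMap.ker_eq_bot.2 (permAct_injective δ))

theorem span_permAct_schurNC {n : ℕ} (δ : Equiv.Perm (Fin n)) :
    Submodule.span ℚ (Set.range fun π : SetPartition n => permAct δ (schurNC π)) = NCSym n := by
  have : FiniteDimensional ℚ (NCSym n) :=
    FiniteDimensional.span_of_finite ℚ (Set.finite_range _)
  refine Submodule.eq_of_le_of_finrank_le ?_ ?_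
  · refine Submodule.span_le.2 ?_
    rintro _ ⟨π, rfl⟩
    exact permAct_mem_NCSym δ (schurNC_mem_NCSym π)
  · rw [finrank_span_eq_card (linearIndependent_permAct_schurNC δ)]
    exact finrank_range_le_card _

/-! ### Two-row shapes detect the order of the places -/

section tworow

variable {n : ℕ}

/-- The set partition with the blocks `{x, y}` and its complement. -/
noncomputable def pairPartition (x y : Fin n) : SetPartition n :=
  ker fun j => decide (j = x ∨ j = y)

/-- The set partition with the blocks `{y}` and its complement. -/
noncomputable def pointPartition (y : Fin n) : SetPartition n :=
  ker fun j => decide (j = y)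

theorem part_pairPartition_eq_iff (x y j k : Fin n) :
    (pairPartition x y).part j = (pairPartition x y).part k ↔
      ((j = x ∨ j = y) ↔ (k = x ∨ k = y)) := by
  rw [pairPartition, part_ker_eq_iff, decide_eq_decide]

theorem part_pointPartition_eq_iff (y j k : Fin n) :
    (pointPartition y).part j = (pointPartition y).part k ↔ (j = y ↔ k = y) := by
  rw [pointPartition, part_ker_eq_iff, decide_eq_decide]

theorem pairPartition_comm (x y : Fin n) : pairPartition x y = pairPartition y x :=
  ext_part fun j k => by simp only [part_pairPartition_eq_iff, or_comm]

theorem perm_pairPartition (γ : Equiv.Perm (Fin n)) (x y : Fin n) :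
    (pairPartition x y).perm γ = pairPartition (γ x) (γ y) := by
  refine ext_part fun j k => ?_
  obtain ⟨j, rfl⟩ := γ.surjective j
  obtain ⟨k, rfl⟩ := γ.surjective k
  simp only [part_perm_eq_iff, part_pairPartition_eq_iff, γ.injective.eq_iff]

theorem perm_pointPartition (γ : Equiv.Perm (Fin n)) (y : Fin n) :
    (pointPartition y).perm γ = pointPartition (γ y) := by
  refine ext_part fun j k => ?_
  obtain ⟨j, rfl⟩ := γ.surjective j
  obtain ⟨k, rfl⟩ := γ.surjective k
  simp only [part_perm_eq_iff, part_pointPartition_eq_iff, γ.injective.eq_iff]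

theorem exists_ne_and_ne (hn : 3 ≤ n) (x y : Fin n) : ∃ z : Fin n, z ≠ x ∧ z ≠ y := by
  obtain ⟨z, hz⟩ : ∃ z, z ∉ ({x, y} : Finset (Fin n)) := by
    by_contra! h
    have hcard := Finset.card_le_card fun z (_ : z ∈ Finset.univ) => h z
    rw [Finset.card_univ, Fintype.card_fin] at hcard
    have := Finset.card_le_two (a := x) (b := y)
    omega
  exact ⟨z, by simpa using hz⟩

theorem pairPartition_ne_pointPartition (hn : 3 ≤ n) {x y : Fin n} (hxy : x ≠ y) :
    pairPartition x y ≠ pointPartition y := by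
  intro h
  obtain ⟨z, hzx, hzy⟩ := exists_ne_and_ne hn x y
  have := part_pairPartition_eq_iff x y z x
  rw [h, part_pointPartition_eq_iff] at this
  simp [hzx, hzy, hxy] at this

theorem pointPartition_injective (hn : 3 ≤ n) :
    Function.Injective (pointPartition : Fin n → SetPartition n) := by
  intro x y h
  by_contra hxy
  obtain ⟨z, hzx, hzy⟩ := exists_ne_and_ne hn x y
  have := part_pointPartition_eq_iff x z y
  rw [h, part_pointPartition_eq_iff] at this
  simp [hzx, hzy, Ne.symm hxy] at this

theorem part_pairPartition_left (x y : Fin n) : (pairPartition x y).part x = {x, y} := by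
  ext k
  rw [mem_part_iff, part_pairPartition_eq_iff]
  simp

theorem part_pairPartition_right (x y : Fin n) : (pairPartition x y).part y = {x, y} := by
  ext k
  rw [mem_part_iff, part_pairPartition_eq_iff]
  simp

theorem part_pairPartition_of_ne {x y z : Fin n} (hzx : z ≠ x) (hzy : z ≠ y) :
    (pairPartition x y).part z = {x, y}ᶜ := by
  ext k
  rw [mem_part_iff, part_pairPartition_eq_iff]
  simp [hzx, hzy]

theorem card_compl_pair {x y : Fin n} (hxy : x ≠ y) : ({x, y}ᶜ : Finset (Fin n)).card = n - 2 := by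
  rw [Finset.card_compl, Fintype.card_fin, Finset.card_pair hxy]

theorem rows_pairPartition (hn : 4 ≤ n) {x y : Fin n} (hxy : x ≠ y) :
    rows (pairPartition x y).shape = [n - 2, 2] := by
  refine rows_eq_of_pairwise (by simp; omega) ?_
  have hparts : (pairPartition x y).parts = {{x, y}ᶜ, {x, y}} := by
    rw [← image_part]
    ext B
    simp only [Finset.mem_image, Finset.mem_univ, true_and, Finset.mem_insert,
      Finset.mem_singleton]
    constructor
    · rintro ⟨z, rfl⟩
      by_cases hzx : z = x
      · exact Or.inr (hzx ▸ part_pairPartition_left x y)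
      · by_cases hzy : z = y
        · exact Or.inr (hzy ▸ part_pairPartition_right x y)
        · exact Or.inl (part_pairPartition_of_ne hzx hzy)
    · rintro (rfl | rfl)
      · obtain ⟨z, hzx, hzy⟩ := exists_ne_and_ne (by omega) x y
        exact ⟨z, part_pairPartition_of_ne hzx hzy⟩
      · exact ⟨x, part_pairPartition_left x y⟩
  have hne : ({x, y}ᶜ : Finset (Fin n)) ∉ ({{x, y}} : Finset (Finset (Fin n))) := by
    rw [Finset.mem_singleton]
    intro h
    have hx : x ∈ ({x, y} : Finset (Fin n)) := Finset.mem_insert_self x {y}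
    exact Finset.mem_compl.1 (h.symm ▸ hx : x ∈ ({x, y}ᶜ : Finset (Fin n))) hx
  have hshape : (pairPartition x y).shape.parts =
      (pairPartition x y).parts.val.map Finset.card := rfl
  rw [hshape, hparts, Finset.insert_val_of_notMem hne, Multiset.map_cons, card_compl_pair hxy,
    Finset.singleton_val, Multiset.map_singleton, Finset.card_pair hxy]
  rfl

/-- The last letter of the reading word is the largest entry of the last row. For `n ≥ 5` the last
row is the block `{x, y}`, as its complement is larger. -/
theorem readingPerm_pairPartition_last (hn : 5 ≤ n) {x y : Fin n} (hxy : x < y) :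
    readingPerm (pairPartition x y) ⟨n - 1, by omega⟩ = y := by
  obtain ⟨j, hj⟩ := (readingPerm (pairPartition x y)).surjective y
  have hjn : j ≤ ⟨n - 1, by omega⟩ := Fin.le_def.2 (Nat.le_sub_one_of_lt j.2)
  have hle := monotone_readingKey (pairPartition x y) hjn
  rw [Function.comp_apply, Function.comp_apply, hj] at hle
  generalize readingPerm (pairPartition x y) ⟨n - 1, by omega⟩ = z at hle ⊢
  rw [readingKey, readingKey, Prod.Lex.toLex_le_toLex, Prod.Lex.toLex_le_toLex] at hle
  by_cases hzy : z = y
  · exact hzy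
  · exfalso
    by_cases hzx : z = x
    · rw [hzx, part_pairPartition_left, part_pairPartition_right] at hle
      simp only [lt_irrefl, false_or, true_and] at hle
      exact absurd hle (not_le.2 hxy)
    · rw [part_pairPartition_right, part_pairPartition_of_ne hzx hzy, card_compl_pair hxy.ne,
        Finset.card_pair hxy.ne] at hle
      have hle : OrderDual.toDual 2 ≤ OrderDual.toDual (n - 2) :=
        hle.elim le_of_lt fun h => h.1.le
      have := OrderDual.toDual_le_toDual.1 hle
      omega

theorem jacobiTrudi_two_rows (a b : ℕ) : jacobiTrudi [a, b + 1] =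
    (([a, b + 1].map fun k : ℕ => (k : ℤ)).map hRow).prod -
      (([a + 1, b].map fun k : ℕ => (k : ℤ)).map hRow).prod := by
  have huniv : (Finset.univ : Finset (Equiv.Perm (Fin 2))) = {1, Equiv.swap 0 1} := by decide
  have hne : (1 : Equiv.Perm (Fin 2)) ≠ Equiv.swap 0 1 := by decide
  have h₁ : shiftedRows [a, b + 1] 1 = [a, b + 1].map fun k : ℕ => (k : ℤ) := shiftedRows_one _
  have h₂ : shiftedRows [a, b + 1] (Equiv.swap (0 : Fin 2) 1) =
      [a + 1, b].map fun k : ℕ => (k : ℤ) := by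
    simp [shiftedRows, List.ofFn_succ]
  rw [jacobiTrudi_eq_sum]
  change ∑ ε : Equiv.Perm (Fin 2), _ = _
  rw [huniv, Finset.sum_pair hne]
  -- The index types `Fin 2` and `Fin [a, b + 1].length` agree only definitionally.
  erw [h₁, h₂]
  simp [sub_eq_add_neg]

theorem runPartition_perm_of_last (hn : 1 ≤ n) (δ : Equiv.Perm (Fin n)) :
    (runPartition n [n - 1, 1]).perm δ = pointPartition (δ ⟨n - 1, by omega⟩) := by
  refine ext_part fun j k => ?_
  obtain ⟨j, rfl⟩ := δ.surjective j
  obtain ⟨k, rfl⟩ := δ.surjective k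
  have hval : ∀ j : Fin n, (runLabels [n - 1, 1]).getD j 0 =
      if j = ⟨n - 1, by omega⟩ then 1 else 0 := by
    intro j
    have hj := j.2
    simp only [runLabels, Fin.ext_iff, List.getD_eq_getElem?_getD]
    split_ifs with h
    · simp [h]
    · have : (j : ℕ) < n - 1 := by omega
      simp [List.getElem?_append, this]
  rw [part_perm_eq_iff, part_pointPartition_eq_iff, runPartition, part_ker_eq_iff, hval, hval,
    δ.injective.eq_iff, δ.injective.eq_iff]
  split_ifs <;> simp_all

theorem exists_schurNC_pairPartition (hn : 5 ≤ n) {x y : Fin n} (hxy : x < y) :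
    ∃ c c' : ℚ, c ≠ 0 ∧ c' ≠ 0 ∧ schurNC (pairPartition x y) =
      c • hNC (pairPartition x y) - c' • hNC (pointPartition y) := by
  refine ⟨_, _, prod_inv_factorial_ne_zero [n - 2, 2], prod_inv_factorial_ne_zero [n - 1, 1], ?_⟩
  have hrows := rows_pairPartition (by omega) hxy.ne
  have hfirst := runPartition_perm_readingPerm (pairPartition x y)
  have hlast := runPartition_perm_of_last (by omega) (readingPerm (pairPartition x y))
  rw [readingPerm_pairPartition_last hn hxy] at hlast
  have hs : schurNC (pairPartition x y) = permAct (readingPerm (pairPartition x y))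
      (jacobiTrudi (rows (pairPartition x y).shape)) := rfl
  rw [hrows] at hfirst hs
  have h₁ : [n - 2, 2].sum = n := by simp; omega
  have h₂ : [n - 1, 1].sum = n := by simp; omega
  rw [hs, jacobiTrudi_two_rows, show n - 2 + 1 = n - 1 by omega, map_sub,
    prod_hRow_eq_smul_hNC h₁, prod_hRow_eq_smul_hNC h₂, map_smul, map_smul, permAct_hNC,
    permAct_hNC, hfirst, hlast]

end tworow

/-- If a place permutation carries Schur functions to Schur functions, then comparing leading terms
`s_π` goes to `s_{γπ}`; for the partitions with blocks `{x, y}` and its complement, the second term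
of the expansion then shows that `γ` preserves the larger one of `x` and `y`. -/
theorem eq_one_of_permAct_schurNC {n : ℕ} (hn : 5 ≤ n) {γ : Equiv.Perm (Fin n)}
    (h : ∀ π : SetPartition n, ∃ σ : SetPartition n, permAct γ (schurNC π) = schurNC σ) : γ = 1 := by
  obtain ⟨a, ha⟩ := exists_schurNC_expansion n
  have hcoef : ∀ {π σ : SetPartition n}, permAct γ (schurNC π) = schurNC σ →
      ∀ τ : SetPartition n, a π τ = a σ (τ.perm γ) := by
    intro π σ hπσ τ
    have hsum : ∑ τ : SetPartition n, a π τ • hNC (τ.perm γ) =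
        ∑ τ : SetPartition n, a σ (τ.perm γ) • hNC (τ.perm γ) := by
      have hbij : Function.Bijective fun τ : SetPartition n => τ.perm γ :=
        Function.bijective_iff_has_inverse.2 ⟨fun τ => τ.perm γ⁻¹,
          fun τ => by simp only [perm_mul, inv_mul_cancel, perm_one],
          fun τ => by simp only [perm_mul, mul_inv_cancel, perm_one]⟩
      rw [hbij.sum_comp fun τ => a σ τ • hNC τ, ← (ha σ).1, ← hπσ, (ha π).1, map_sum]
      exact Finset.sum_congr rfl fun τ _ => by rw [map_smul, permAct_hNC]
    have hind : LinearIndependent ℚ fun τ : SetPartition n => hNC (τ.perm γ) := by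
      have := (linearIndependent_hNC n).map' (permAct γ)
        (LinearMap.ker_eq_bot.2 (permAct_injective γ))
      simpa only [Function.comp_def, permAct_hNC] using this
    exact Fintype.linearIndependent_iffₛ.1 hind _ _ hsum τ
  have hpair : ∀ {x y : Fin n}, x < y → ∀ τ, a (pairPartition x y) τ ≠ 0 ↔
      τ = pairPartition x y ∨ τ = pointPartition y := by
    intro x y hxy τ
    obtain ⟨c, c', hc, hc', hcc⟩ := exists_schurNC_pairPartition hn hxy
    have hne := pairPartition_ne_pointPartition (by omega) hxy.ne
    have hsum : ∑ τ, a (pairPartition x y) τ • hNC τ = ∑ τ,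
        ((if τ = pairPartition x y then c else 0) - if τ = pointPartition y then c' else 0) •
          hNC τ := by
      simp only [sub_smul, ite_smul, zero_smul, Finset.sum_sub_distrib, Finset.sum_ite_eq',
        Finset.mem_univ, if_true]
      rw [← hcc, ← (ha _).1]
    have hτ := Fintype.linearIndependent_iffₛ.1 (linearIndependent_hNC n) _ _ hsum τ
    rw [hτ]
    by_cases hP : τ = pairPartition x y
    · subst hP
      simp [hne, hc]
    · by_cases hQ : τ = pointPartition y
      · simp [hQ, hc', hne.symm]
      · simp [hP, hQ]
  refine (Equiv.Perm.monotone_iff γ).1 (StrictMono.monotone fun x y hxy => ?_)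
  obtain ⟨σ, hσ⟩ := h (pairPartition x y)
  have hPQ := pairPartition_ne_pointPartition (by omega) hxy.ne
  have hP := (hpair hxy _).2 (Or.inl rfl)
  have hQ := (hpair hxy _).2 (Or.inr rfl)
  have hlt := ((ha _).2.2 _ hQ).resolve_left hPQ.symm
  rw [hcoef hσ] at hP hQ
  have hσP : σ = (pairPartition x y).perm γ := by
    rcases (ha σ).2.2 _ hP with h | h
    · exact h.symm
    · -- The leading term of `s_σ` is the image of one of the two terms of `s_π`; it is not the
      -- second one, which has more coincidences than the first.
      have hinv : (σ.perm γ⁻¹).perm γ = σ := by rw [perm_mul, mul_inv_cancel, perm_one]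
      have hσσ := (ha σ).2.1
      nth_rw 2 [← hinv] at hσσ
      rw [← hcoef hσ, hpair hxy] at hσσ
      rcases hσσ with hσσ | hσσ
      · rw [← hσσ, hinv]
      · rw [← hinv, hσσ, coincidences_perm, coincidences_perm] at h
        exact absurd h (not_lt.2 hlt.le)
  rw [hσP, perm_pairPartition, perm_pointPartition] at hQ
  rcases lt_trichotomy (γ x) (γ y) with hγ | hγ | hγ
  · exact hγ
  · exact absurd (γ.injective hγ) hxy.ne
  · exfalso
    rw [pairPartition_comm, hpair hγ] at hQ
    rcases hQ with hQ | hQ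
    · exact pairPartition_ne_pointPartition (by omega) hγ.ne' (pairPartition_comm _ _ ▸ hQ.symm)
    · exact hγ.ne (pointPartition_injective (by omega) hQ)

theorem eq_of_range_permAct_schurNC_eq {n : ℕ} (hn : 5 ≤ n) {δ η : Equiv.Perm (Fin n)}
    (h : (Set.range fun π : SetPartition n => permAct δ (schurNC π)) =
      Set.range fun π : SetPartition n => permAct η (schurNC π)) : δ = η := by
  have h1 : η⁻¹ * δ = 1 := by
    refine eq_one_of_permAct_schurNC hn fun π => ?_
    have hmem : permAct δ (schurNC π) ∈
        Set.range fun π : SetPartition n => permAct η (schurNC π) := h ▸ ⟨π, rfl⟩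
    obtain ⟨σ, hσ⟩ := hmem
    refine ⟨σ, ?_⟩
    rw [← permAct_permAct, ← hσ]
    dsimp only
    rw [permAct_permAct, inv_mul_cancel, permAct_one]
  exact (inv_mul_eq_one.1 h1).symm

end NCSchur

/-- Let `n ≥ 5`. For every permutation `δ`, the family `δ ∘ s_π`, indexed by the set partitions `π`
of `[n]`, is a basis of `NCSym^n`; it differs as a set from the Schur basis unless `δ = id`;
distinct permutations give distinct bases, so that there are `n!` of them;
and `ρ (δ ∘ s_π) = s_{λ(π)}`. -/
theorem corollary4p6 (n : ℕ) (hn : 5 ≤ n) :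
    (∀ δ : Equiv.Perm (Fin n),
      LinearIndependent ℚ
          (fun π : NCSchur.SetPartition n => NCSchur.permAct δ (NCSchur.schurNC π)) ∧
        Submodule.span ℚ
          (Set.range fun π : NCSchur.SetPartition n => NCSchur.permAct δ (NCSchur.schurNC π)) =
            NCSchur.NCSym n) ∧
    (LinearIndependent ℚ (fun π : NCSchur.SetPartition n => NCSchur.schurNC π) ∧
      Submodule.span ℚ (Set.range fun π : NCSchur.SetPartition n => NCSchur.schurNC π) =
        NCSchur.NCSym n) ∧
    (∀ δ : Equiv.Perm (Fin n), δ ≠ 1 →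
      (Set.range fun π : NCSchur.SetPartition n => NCSchur.schurNC π) ≠
        Set.range fun π : NCSchur.SetPartition n => NCSchur.permAct δ (NCSchur.schurNC π)) ∧
    (∀ δ η : Equiv.Perm (Fin n),
      (Set.range fun π : NCSchur.SetPartition n => NCSchur.permAct δ (NCSchur.schurNC π)) =
        (Set.range fun π : NCSchur.SetPartition n => NCSchur.permAct η (NCSchur.schurNC π)) →
      δ = η) ∧
    Set.ncard {B : Set NCSchur.NCSeries | ∃ δ : Equiv.Perm (Fin n),
      B = Set.range fun π : NCSchur.SetPartition n =>
        NCSchur.permAct δ (NCSchur.schurNC π)} = n.factorial ∧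
    (∀ (δ : Equiv.Perm (Fin n)) (π : NCSchur.SetPartition n),
      NCSchur.rho (NCSchur.permAct δ (NCSchur.schurNC π)) = NCSchur.schur π.shape) := by
  have hone : (fun π : NCSchur.SetPartition n => NCSchur.schurNC π) =
      fun π => NCSchur.permAct (1 : Equiv.Perm (Fin n)) (NCSchur.schurNC π) :=
    funext fun π => (NCSchur.permAct_one _).symm
  refine ⟨fun δ => ⟨NCSchur.linearIndependent_permAct_schurNC δ, NCSchur.span_permAct_schurNC δ⟩,
    ⟨NCSchur.linearIndependent_schurNC n, ?_⟩, fun δ hδ h => hδ ?_,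
    fun δ η h => NCSchur.eq_of_range_permAct_schurNC_eq hn h, ?_, fun δ π => ?_⟩
  · rw [hone]
    exact NCSchur.span_permAct_schurNC 1
  · rw [hone] at h
    exact (NCSchur.eq_of_range_permAct_schurNC_eq hn h).symm
  · set F : Equiv.Perm (Fin n) → Set NCSchur.NCSeries := fun δ =>
      Set.range fun π : NCSchur.SetPartition n => NCSchur.permAct δ (NCSchur.schurNC π) with hF
    have hinj : Function.Injective F := fun δ η h => NCSchur.eq_of_range_permAct_schurNC_eq hn h
    have hset : {B : Set NCSchur.NCSeries | ∃ δ : Equiv.Perm (Fin n), B = F δ} =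
        F '' Set.univ := by
      ext B
      simp [eq_comm]
    rw [hset, Set.ncard_image_of_injective _ hinj, Set.ncard_univ, Nat.card_eq_fintype_card,
      Fintype.card_perm, Fintype.card_fin]
  · rw [NCSchur.rho_permAct, NCSchur.rho_schurNC]
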